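/- **Setting.** Let $M_p(0,\infty)$ be the set of counting measures $m=\sum_i\delta_{x_i}$ (at most countably many points) on $(0,\infty)$ that are finite on $(u,\infty)$ for every $u>0$. It carries the vague topology, i.e. the coarsest one making $m\mapsto\int f\,dm$ continuous for all bounded continuous $f$ supported in $(r,\infty)$ for some $r>0$. Let $M_{p,f}$ and $M_{p,1}$ be the sets of those $m\in M_p(0,\infty)$ whose points have finite sum, respectively sum $1$; $M_{p,1}$, the space of mass-partitions, has the subspace topology and its Borel $\sigma$-algebra. For $m=\sum_i\delta_{x_i}\in M_{p,f}$, $m\ne0$, put $\mathcal V(m)=\sum_i\delta_{x_i/\sum_jx_j}\in M_{p,1}$. For $\theta>0$, $\mathrm{PD}(0,\theta)$ is the law of $\mathcal V\big(\sum_{T_i\le\theta}\delta_{P_i}\big)$, where $\sum_i\delta_{(T_i,P_i)}$ is a Poisson process on $(0,\infty)^2$ with intensity $dt\otimes x^{-1}e^{-x}dx$. For $\alpha\in(0,1)$ let $\mu_\alpha(dx)=\frac{\alpha}{\Gamma(1-\alpha)}x^{-\alpha-1}dx$ on $(0,\infty)$, let $\sum_i\delta_{(T_i,P_i,E_i)}$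 be a Poisson process on $(0,\infty)^3$ with intensity $dt\otimes\mu_\alpha(dx)\otimes e^{-e}de$, and for $s>0$ let $$N^\vee_s=\sum_{i:\,T_i\le s,\ P_i\le E_i}\delta_{P_i}.$$ Let further $(D_i)_{i\ge1}$ be i.i.d. standard exponential and, independent of them, $(G_i)_{i\ge1}$ i.i.d. $\mathrm{gamma}(1-\alpha,1)$ random variables, $\Gamma_i=D_1+\dots+D_i$, and $$M^\vee_s=\sum_{i\ge1}\delta_{G_i\,(s/(s+\Gamma_i))^{1/\alpha}}.$$ **Proposition.** Let $\theta>0$. Then $\sum_{T_i\le\theta}\delta_{P_i}$ in the definition of $\mathrm{PD}(0,\theta)$, and, for every $\alpha\in(0,1)$, $N^\vee_{\theta/\alpha}$ and $M^\vee_{\theta/\alpha}$, almost surely are non-zero and belong to $M_{p,f}$, and the random mass-partitions $\mathcal V(N^\vee_{\theta/\alpha})$ and $\mathcal V(M^\vee_{\theta/\alpha})$ both converge in distribution in $M_{p,1}$ to $\mathrm{PD}(0,\theta)$ as $\alpha\to0^+$. -/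

import Mathlib

open MeasureTheory ProbabilityTheory Filter
open scoped ENNReal NNReal BoundedContinuousFunction Topology

namespace PDLimit

noncomputable section

/-! ### Counting measures and Poisson processes -/

/-- `m` is a counting measure: a countable (finite or infinite) sum `∑ i, δ_{x i}`. -/
def IsCounting {E : Type*} [MeasurableSpace E] (m : Measure E) : Prop :=
  ∃ (ι : Type) (_ : Countable ι) (x : ι → E), m = Measure.sum fun i => Measure.dirac (x i)

/-- The Poisson distribution with mean `m ∈ [0, ∞]`, as a law on `[0, ∞]`;
for `m = ∞` it is the point mass at `∞`. -/
def poissonLaw (m : ℝ≥0∞) : Measure ℝ≥0∞ :=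
  if m = ∞ then Measure.dirac ∞ else (poissonMeasure m.toNNReal).map fun n : ℕ => (n : ℝ≥0∞)

/-- The random measure `N`, defined on the probability space `(Ω, P)`, is a Poisson (point) process
with intensity measure `μ`: it is a random counting measure, `N(B)` is Poisson with mean `μ(B)` for
every measurable `B`, and the counts of pairwise disjoint measurable sets are independent. -/
structure IsPoissonProcess {Ω E : Type*} [MeasurableSpace Ω] [MeasurableSpace E]
    (N : Ω → Measure E) (μ : Measure E) (P : Measure Ω) : Prop where
  measurable : Measurable N
  counting : ∀ ω, IsCounting (N ω)
  law_count : ∀ B, MeasurableSet B → P.map (fun ω => N ω B) = poissonLaw (μ B)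
  indep_count : ∀ (n : ℕ) (B : Fin n → Set E), (∀ i, MeasurableSet (B i)) →
    Pairwise (Function.onFun Disjoint B) → iIndepFun (fun i ω => N ω (B i)) P

/-! ### The spaces of counting measures with finite sum and with sum one -/

/-- The sum `∑ i, x i` of the points of `∑ i, δ_{x i}`, with values in `[0, ∞]`. -/
def total (m : Measure ℝ) : ℝ≥0∞ := ∫⁻ x, ENNReal.ofReal x ∂m

/-- `m` belongs to `M_p(0,∞)`: it is a counting measure on `(0,∞)` (viewed as a measure on `ℝ` that
does not charge `(-∞,0]`) which is finite on `(u,∞)` for all `u > 0`. -/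
structure IsMp (m : Measure ℝ) : Prop where
  counting : IsCounting m
  pos : m (Set.Iic 0) = 0
  finite : ∀ u : ℝ, 0 < u → m (Set.Ioi u) < ∞

/-- `m` belongs to `M_{p,f}`: the points have a finite sum. -/
def IsMpf (m : Measure ℝ) : Prop := IsMp m ∧ total m < ∞

/-- `m` belongs to `M_{p,1}`: the points sum up to one. -/
def IsMpOne (m : Measure ℝ) : Prop := IsMp m ∧ total m = 1

/-- The space `M_{p,1}` of mass-partitions. -/
structure MassPartition where
  toMeasure : Measure ℝ
  isMpOne : IsMpOne toMeasure

/-- Test functions of the vague topology on `M_p(0,∞)`: bounded continuous functions supported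
in `(r,∞)` for some `r > 0`. -/
def TestFunction : Type :=
  {f : ℝ →ᵇ ℝ // ∃ r : ℝ, 0 < r ∧ ∀ x ≤ r, f x = 0}

/-- The vague topology: the coarsest one for which `m ↦ ∫ f dm` is continuous for every test
function `f`. -/
instance : TopologicalSpace MassPartition :=
  TopologicalSpace.induced
    (fun (m : MassPartition) (f : TestFunction) => ∫ x, f.1 x ∂m.toMeasure) inferInstance

instance : MeasurableSpace MassPartition := borel MassPartition

instance : BorelSpace MassPartition := ⟨rfl⟩

/-! ### Self-normalization -/

/-- The measure `∑ i, δ_{x i / ∑ j, x j}` obtained from `m = ∑ i, δ_{x i}`. -/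
def normalize (m : Measure ℝ) : Measure ℝ := m.map fun x => x / (total m).toReal

theorem IsCounting.map {E F : Type*} [MeasurableSpace E] [MeasurableSpace F] {m : Measure E}
    (h : IsCounting m) {g : E → F} (hg : Measurable g) : IsCounting (m.map g) := by
  obtain ⟨ι, hι, x, rfl⟩ := h
  refine ⟨ι, hι, fun i => g (x i), ?_⟩
  rw [Measure.map_sum hg.aemeasurable]
  simp_rw [Measure.map_dirac' hg]

theorem total_ne_zero {m : Measure ℝ} (h : IsMp m) (h0 : m ≠ 0) : total m ≠ 0 := by
  intro ht
  rw [total, lintegral_eq_zero_iff (by fun_prop)] at ht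
  apply h0
  have h1 : ∀ᵐ x ∂m, x ∈ Set.Iic (0 : ℝ) := by
    filter_upwards [ht] with x hx
    simpa using hx
  have h2 : ∀ᵐ x ∂m, x ∉ Set.Iic (0 : ℝ) := measure_eq_zero_iff_ae_notMem.1 h.pos
  rw [← ae_eq_bot, ← eventually_false_iff_eq_bot]
  filter_upwards [h1, h2] with x hx hx'
  exact hx' hx

theorem isMpOne_normalize {m : Measure ℝ} (h : IsMpf m) (h0 : m ≠ 0) :
    IsMpOne (normalize m) := by
  have ht0 : total m ≠ 0 := total_ne_zero h.1 h0
  have ht : 0 < (total m).toReal := ENNReal.toReal_pos ht0 h.2.ne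
  have hg : Measurable fun x : ℝ => x / (total m).toReal := by fun_prop
  refine ⟨⟨h.1.counting.map hg, ?_, ?_⟩, ?_⟩
  · rw [normalize, Measure.map_apply hg measurableSet_Iic]
    convert h.1.pos using 2
    ext x
    simp [div_le_iff₀ ht]
  · intro u hu
    rw [normalize, Measure.map_apply hg measurableSet_Ioi]
    convert h.1.finite (u * (total m).toReal) (by positivity) using 2
    ext x
    simp [lt_div_iff₀ ht]
  · rw [total, normalize, lintegral_map (by fun_prop) hg]
    simp_rw [ENNReal.ofReal_div_of_pos ht, ENNReal.ofReal_toReal h.2.ne, div_eq_mul_inv]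
    rw [lintegral_mul_const _ (by fun_prop)]
    exact ENNReal.mul_inv_cancel ht0 h.2.ne

theorem isMpOne_dirac : IsMpOne (Measure.dirac 1) := by
  refine ⟨⟨⟨Unit, inferInstance, fun _ => 1, by simp⟩, ?_, fun u _ => ?_⟩, ?_⟩
  · simp
  · exact measure_lt_top _ _
  · simp [total]

open Classical in
/-- The self-normalization map `𝒱 : M_{p,f} ∖ {0} → M_{p,1}`, `∑ i, δ_{x i} ↦ ∑ i, δ_{x i / ∑ j, x j}`;
outside its domain it is given the irrelevant value `δ_1`. -/
def selfNormalize (m : Measure ℝ) : MassPartition :=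
  if h : IsMpf m ∧ m ≠ 0 then ⟨normalize m, isMpOne_normalize h.1 h.2⟩
  else ⟨Measure.dirac 1, isMpOne_dirac⟩

/-! ### The processes -/

/-- Lebesgue measure on the time axis `(0,∞)`. -/
def lebPos : Measure ℝ := volume.restrict (Set.Ioi 0)

/-- The measure `x⁻¹ e^{-x} dx` on `(0,∞)`. -/
def gammaLevy : Measure ℝ :=
  lebPos.withDensity fun x => ENNReal.ofReal (x⁻¹ * Real.exp (-x))

/-- The measure `μ_α(dx) = α / Γ(1-α) · x^{-(α+1)} dx` on `(0,∞)`. -/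
def stableLevy (α : ℝ) : Measure ℝ :=
  lebPos.withDensity fun x => ENNReal.ofReal (α / Real.Gamma (1 - α) * (1 / x ^ (α + 1)))

/-- `∑_{t i ≤ s} δ_{p i}` for a counting measure `∑ i, δ_{(t i, p i)}`. -/
def jumpsUpTo (s : ℝ) (m : Measure (ℝ × ℝ)) : Measure ℝ :=
  (m.restrict {q | q.1 ≤ s}).map Prod.snd

/-- The thinning `∑ i, δ_{(t i, p i)} 1{p i ≤ e i}` of a marked counting measure
`∑ i, δ_{(t i, p i, e i)}`. -/
def thin (m : Measure (ℝ × ℝ × ℝ)) : Measure (ℝ × ℝ) :=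
  (m.restrict {q | q.2.1 ≤ q.2.2}).map fun q => (q.1, q.2.1)

/-- The point process `N^∨_s = ∑_{t i ≤ s} δ_{p i} 1{p i ≤ e i}`, where
`N = ∑ i, δ_{(t i, p i, e i)}`. -/
def Nvee {Ω : Type*} (N : Ω → Measure (ℝ × ℝ × ℝ)) (s : ℝ) (ω : Ω) : Measure ℝ :=
  jumpsUpTo s (thin (N ω))

/-- The `i`-th arrival time `D 0 + ⋯ + D i`. -/
def arrival {Ω : Type*} (D : ℕ → Ω → ℝ) (i : ℕ) (ω : Ω) : ℝ :=
  ∑ j ∈ Finset.range (i + 1), D j ω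

/-- The point process `M^∨_s = ∑ i, δ_{G i · (s / (s + Γ i)) ^ (1/α)}`, where `Γ i` are the
arrival times with interarrival times `D`. -/
def Mvee {Ω : Type*} (α : ℝ) (D G : ℕ → Ω → ℝ) (s : ℝ) (ω : Ω) : Measure ℝ :=
  Measure.sum fun i => Measure.dirac (G i ω * (s / (s + arrival D i ω)) ^ (1 / α))

end

end PDLimit

namespace PDLimit

noncomputable section

/-! ### The function `x ↦ e^{-x}` on `[0, ∞]` -/

/-! All the processes are compared through Laplace functionals. Let ν_α be the measure θ/Γ(1-α) ·
x^{-α-1} e^{-x} dx on (0,∞); for α = 0 it is θ x^{-1} e^{-x} dx. Each process X satisfies E exp(-∫ f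
dX) = exp(-∫ (1 - e^{-f}) dν_α), at least for continuous ν_α-integrable f ≥ 0, with α = 0 for the
gamma jumps. For `Nvee`, a jump x survives the thinning with probability e^{-x}, and the time θ/α
turns the constant α of the stable measure into θ. For `Mvee`, a renewal identity gives the Laplace
functional of the marked arrival times directly, and ν_α is the image of dt ⊗ gamma(1-α,1) under the
map (t,g) ↦ g(s/(s+t))^{1/α}, s = θ/α. As α → 0 the exponents converge by dominated convergence
(`tendsto_lintegral_jumpIntensity`).

It remains to pass from Laplace functionals to self-normalized measures. On mass-partitions the
vague topology is generated by the power sums ∑ x_i^{k+1} (`isInducing_powerSums`): since the points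
sum to one, an error of size εx in the integrand costs at most ε. The numbers exp(-∑ x_i^{k+1})
place a measure in the Hilbert cube, and the mixed moments of this random point are exactly Laplace
functionals at polynomials without constant term and with coefficients in ℕ
(`integral_expMoment_prod`). By Stone–Weierstrass, their convergence gives weak convergence on the
cube. The normalized power sums are a function of the cube point that is continuous at almost every
point that matters, which carries the convergence over to mass-partitions
(`tendstoInDistribution_selfNormalize`). -/

/-- The function `x ↦ e^{-x}` on `[0, ∞]`, with `e^{-∞} = 0`. -/
def expNeg (x : ℝ≥0∞) : ℝ≥0∞ := (EReal.exp x)⁻¹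

@[simp] theorem expNeg_zero : expNeg 0 = 1 := by simp [expNeg]

@[simp] theorem expNeg_top : expNeg ∞ = 0 := by simp [expNeg]

theorem expNeg_add (x y : ℝ≥0∞) : expNeg (x + y) = expNeg x * expNeg y := by
  have h : ∀ z : ℝ≥0∞, EReal.exp z ≠ 0 := fun z => by simp
  rw [expNeg, EReal.coe_ennreal_add, EReal.exp_add, ENNReal.mul_inv (.inl (h x)) (.inr (h y))]
  rfl

theorem expNeg_antitone : Antitone expNeg := fun x y h => by
  simpa [expNeg] using h

theorem expNeg_le_one (x : ℝ≥0∞) : expNeg x ≤ 1 := by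
  simpa using expNeg_antitone (zero_le (a := x))

theorem expNeg_ne_top (x : ℝ≥0∞) : expNeg x ≠ ∞ :=
  ((expNeg_le_one x).trans_lt ENNReal.one_lt_top).ne

@[simp] theorem expNeg_eq_zero {x : ℝ≥0∞} : expNeg x = 0 ↔ x = ∞ := by simp [expNeg]

@[simp] theorem expNeg_eq_one {x : ℝ≥0∞} : expNeg x = 1 ↔ x = 0 := by
  rw [expNeg, ENNReal.inv_eq_one, ← EReal.exp_zero, EReal.exp_strictMono.injective.eq_iff]
  simp

theorem continuous_expNeg : Continuous expNeg :=
  (ENNReal.continuous_exp.comp continuous_coe_ennreal_ereal).inv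

@[fun_prop]
theorem measurable_expNeg : Measurable expNeg := continuous_expNeg.measurable

theorem expNeg_ofReal {x : ℝ} (hx : 0 ≤ x) :
    expNeg (ENNReal.ofReal x) = ENNReal.ofReal (Real.exp (-x)) := by
  rw [expNeg, EReal.coe_ennreal_ofReal, max_eq_left hx, EReal.exp_coe,
    ← ENNReal.ofReal_inv_of_pos (Real.exp_pos x), Real.exp_neg]

theorem expNeg_toReal {x : ℝ≥0∞} (hx : x ≠ ∞) : (expNeg x).toReal = Real.exp (-x.toReal) := by
  conv_lhs => rw [← ENNReal.ofReal_toReal hx, expNeg_ofReal ENNReal.toReal_nonneg]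
  exact ENNReal.toReal_ofReal (Real.exp_pos _).le

theorem expNeg_sum {ι : Type*} (s : Finset ι) (f : ι → ℝ≥0∞) :
    expNeg (∑ i ∈ s, f i) = ∏ i ∈ s, expNeg (f i) := by
  classical
  induction s using Finset.induction_on with
  | empty => simp
  | insert i s hi ih => rw [Finset.sum_insert hi, Finset.prod_insert hi, expNeg_add, ih]

theorem expNeg_nat_mul (n : ℕ) (x : ℝ≥0∞) : expNeg (n * x) = expNeg x ^ n := by
  rw [← nsmul_eq_mul, ← Finset.card_range n, ← Finset.sum_const, expNeg_sum]
  simp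

theorem one_sub_expNeg_le (x : ℝ≥0∞) : 1 - expNeg x ≤ x := by
  rcases eq_or_ne x ∞ with rfl | hx
  · simp
  rw [tsub_le_iff_right, ← ENNReal.ofReal_toReal hx, expNeg_ofReal ENNReal.toReal_nonneg,
    ← ENNReal.ofReal_add ENNReal.toReal_nonneg (Real.exp_pos _).le, ← ENNReal.ofReal_one]
  exact ENNReal.ofReal_le_ofReal (by linarith [Real.add_one_le_exp (-x.toReal)])

theorem continuous_one_sub_expNeg : Continuous fun x => 1 - expNeg x :=
  (ENNReal.continuous_sub_left ENNReal.one_ne_top).comp continuous_expNeg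

/-! ### The Laplace functional of a Poisson process -/

/-- This is the Poisson generating function at q = e^{-c}. For m = ∞ both sides agree through the
convention 0 · ∞ = 0, which decides the case c = 0. -/
theorem lintegral_expNeg_poissonLaw (m c : ℝ≥0∞) :
    ∫⁻ x, expNeg (c * x) ∂poissonLaw m = expNeg ((1 - expNeg c) * m) := by
  rw [poissonLaw]
  split_ifs with hm
  · rw [lintegral_dirac, hm]
    rcases eq_or_ne c 0 with rfl | hc
    · simp
    · have : 1 - expNeg c ≠ 0 := by
        rw [Ne, tsub_eq_zero_iff_le, not_le]
        exact lt_of_le_of_ne (expNeg_le_one c) (by simpa using hc)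
      rw [ENNReal.mul_top hc, ENNReal.mul_top this]
  · rw [lintegral_map (by fun_prop) (by fun_prop), lintegral_countable']
    set r := m.toNNReal
    have hr : m = ENNReal.ofReal r := by simp [r, hm]
    set q := (expNeg c).toReal
    have hq0 : 0 ≤ q := ENNReal.toReal_nonneg
    have hq1 : q ≤ 1 := ENNReal.toReal_le_of_le_ofReal zero_le_one (by simpa using expNeg_le_one c)
    have hqc : expNeg c = ENNReal.ofReal q := (ENNReal.ofReal_toReal (expNeg_ne_top c)).symm
    have h1 : ∀ n : ℕ, expNeg (c * n) * poissonMeasure r {n}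
        = ENNReal.ofReal (Real.exp (-r) * ((q * r) ^ n / n.factorial)) := fun n => by
      rw [poissonMeasure_singleton, mul_comm c, expNeg_nat_mul, hqc, ← ENNReal.ofReal_pow hq0,
        ← ENNReal.ofReal_mul (by positivity)]
      congr 1
      rw [mul_pow]
      ring
    have h2 : HasSum (fun n : ℕ => Real.exp (-r) * ((q * r) ^ n / n.factorial))
        (Real.exp (-r) * Real.exp (q * r)) := by
      rw [Real.exp_eq_exp_ℝ]
      exact (NormedSpace.expSeries_div_hasSum_exp (q * (r : ℝ))).mul_left _
    simp_rw [h1]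
    rw [← ENNReal.ofReal_tsum_of_nonneg (fun n => by positivity) h2.summable, h2.tsum_eq,
      ← Real.exp_add, hqc, hr, ← ENNReal.ofReal_one, ← ENNReal.ofReal_sub _ hq0,
      ← ENNReal.ofReal_mul (by linarith), expNeg_ofReal (x := (1 - q) * r) (mul_nonneg (by linarith) r.2)]
    congr 2
    ring

theorem tendsto_lintegral_one_sub_expNeg_eapprox {E : Type*} [MeasurableSpace E] (μ : Measure E)
    {f : E → ℝ≥0∞} (hf : Measurable f) :
    Tendsto (fun n => ∫⁻ x, (1 - expNeg (SimpleFunc.eapprox f n x)) ∂μ) atTop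
      (𝓝 (∫⁻ x, (1 - expNeg (f x)) ∂μ)) := by
  refine lintegral_tendsto_of_tendsto_of_monotone (fun n => ?_) ?_ ?_
  · exact (continuous_one_sub_expNeg.measurable.comp (SimpleFunc.measurable _)).aemeasurable
  · refine ae_of_all _ fun x m n hmn => ?_
    exact tsub_le_tsub_left (expNeg_antitone (SimpleFunc.monotone_eapprox f hmn x)) _
  · exact ae_of_all _ fun x =>
      (continuous_one_sub_expNeg.tendsto _).comp (SimpleFunc.tendsto_eapprox hf x)

/-- The level sets of a simple function are disjoint, so their counts are independent and the
expectation factors into one-dimensional Poisson transforms. -/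
theorem IsPoissonProcess.laplace_simpleFunc {Ω E : Type*} [MeasurableSpace Ω] [MeasurableSpace E]
    {N : Ω → Measure E} {μ : Measure E} {P : Measure Ω}
    (h : IsPoissonProcess N μ P) (f : SimpleFunc E ℝ≥0∞) :
    ∫⁻ ω, expNeg (∫⁻ x, f x ∂N ω) ∂P = expNeg (∫⁻ x, (1 - expNeg (f x)) ∂μ) := by
  have hB : ∀ B, MeasurableSet B → Measurable fun ω => N ω B := fun B hB =>
    (Measure.measurable_coe hB).comp h.measurable
  let e := f.range.equivFin
  have hr : ∫⁻ x, (1 - expNeg (f x)) ∂μ = ∑ c ∈ f.range, (1 - expNeg c) * μ (f ⁻¹' {c}) := by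
    rw [← SimpleFunc.map_lintegral, ← SimpleFunc.lintegral_eq_lintegral]
    rfl
  have hind : iIndepFun (fun c : f.range => fun ω => N ω (f ⁻¹' {(c : ℝ≥0∞)})) P := by
    have := h.indep_count f.range.card (fun i => f ⁻¹' {((e.symm i : f.range) : ℝ≥0∞)})
      (fun i => f.measurableSet_fiber _) (fun i j hij => by
        refine Disjoint.preimage _ ?_
        simpa using fun h' => hij (e.symm.injective (Subtype.ext h')))
    simpa [Function.comp_def] using! this.precomp e.injective
  have hl : ∀ ω, ∫⁻ x, f x ∂N ω = ∑ c ∈ f.range, c * N ω (f ⁻¹' {c}) := fun ω => by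
    rw [SimpleFunc.lintegral_eq_lintegral]
    rfl
  rw [hr]
  simp_rw [hl, expNeg_sum]
  rw [← Finset.prod_coe_sort f.range]
  simp_rw [fun ω => (Finset.prod_coe_sort f.range
    (fun c => expNeg (c * N ω (f ⁻¹' {c})))).symm]
  rw [lintegral_prod_eq_prod_lintegral_of_indepFun Finset.univ
    (fun (c : f.range) ω => expNeg ((c : ℝ≥0∞) * N ω (f ⁻¹' {(c : ℝ≥0∞)})))]
  · refine Finset.prod_congr rfl fun c _ => ?_
    rw [← lintegral_expNeg_poissonLaw, ← h.law_count _ (f.measurableSet_fiber _),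
      lintegral_map (by fun_prop) (hB _ (f.measurableSet_fiber _))]
  · exact hind.comp (fun (c : f.range) x => expNeg ((c : ℝ≥0∞) * x)) fun c => by fun_prop
  · intro c
    have := hB _ (f.measurableSet_fiber c)
    fun_prop

/-- The Laplace functional of a Poisson process. -/
theorem IsPoissonProcess.laplace {Ω E : Type*} [MeasurableSpace Ω] [MeasurableSpace E]
    {N : Ω → Measure E} {μ : Measure E} {P : Measure Ω} [IsProbabilityMeasure P]
    (h : IsPoissonProcess N μ P) {f : E → ℝ≥0∞} (hf : Measurable f) :
    ∫⁻ ω, expNeg (∫⁻ x, f x ∂N ω) ∂P = expNeg (∫⁻ x, (1 - expNeg (f x)) ∂μ) := by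
  refine tendsto_nhds_unique (f := fun n => ∫⁻ ω, expNeg (∫⁻ x, SimpleFunc.eapprox f n x ∂N ω) ∂P)
    (l := atTop) ?_ ?_
  · refine tendsto_lintegral_of_dominated_convergence (fun _ => 1) (fun n => ?_)
      (fun n => ae_of_all _ fun ω => expNeg_le_one _) (by simp) (ae_of_all _ fun ω => ?_)
    · exact measurable_expNeg.comp
        ((Measure.measurable_lintegral (SimpleFunc.measurable _)).comp h.measurable)
    · refine (continuous_expNeg.tendsto _).comp ?_
      exact lintegral_tendsto_of_tendsto_of_monotone
        (fun n => (SimpleFunc.measurable _).aemeasurable)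
        (ae_of_all _ fun x m n hmn => SimpleFunc.monotone_eapprox f hmn x)
        (ae_of_all _ fun x => SimpleFunc.tendsto_eapprox hf x)
  · simp_rw [h.laplace_simpleFunc]
    exact (continuous_expNeg.tendsto _).comp (tendsto_lintegral_one_sub_expNeg_eapprox μ hf)

/-! ### The topology of the space of mass-partitions -/

theorem IsCounting.ae_le_one {m : Measure ℝ} (h : IsCounting m) (ht : total m = 1) :
    ∀ᵐ x ∂m, x ≤ 1 := by
  obtain ⟨ι, hι, x, rfl⟩ := h
  rw [Measure.ae_sum_iff]
  intro i
  rw [ae_dirac_iff measurableSet_Iic]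
  have h1 : ENNReal.ofReal (x i) ≤ 1 := by
    rw [← ht, total, lintegral_sum_measure]
    simp_rw [lintegral_dirac' _ ENNReal.measurable_ofReal]
    exact ENNReal.le_tsum i
  simpa using h1

theorem IsMp.ae_pos {m : Measure ℝ} (h : IsMp m) : ∀ᵐ x ∂m, 0 < x := by
  filter_upwards [measure_eq_zero_iff_ae_notMem.1 h.pos] with x hx using not_le.1 hx

theorem IsMpOne.ae_mem {m : Measure ℝ} (h : IsMpOne m) : ∀ᵐ x ∂m, x ∈ Set.Ioc (0 : ℝ) 1 := by
  filter_upwards [h.1.ae_pos, h.1.counting.ae_le_one h.2] with x hx hx' using ⟨hx, hx'⟩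

theorem IsMpOne.integrable_id {m : Measure ℝ} (h : IsMpOne m) : Integrable (fun x => x) m := by
  refine ⟨by fun_prop, ?_⟩
  rw [hasFiniteIntegral_iff_ofReal (h.1.ae_pos.mono fun x hx => hx.le)]
  exact (h.2.trans_lt ENNReal.one_lt_top :)

theorem IsMpOne.integral_id {m : Measure ℝ} (h : IsMpOne m) : ∫ x, x ∂m = 1 := by
  rw [integral_eq_lintegral_of_nonneg_ae (h.1.ae_pos.mono fun x hx => hx.le) (by fun_prop)]
  have := h.2
  rw [total] at this
  simp [this]

theorem IsMpOne.integrable_of_abs_le {m : Measure ℝ} (h : IsMpOne m) {F : ℝ → ℝ}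
    (hF : Continuous F) (C : ℝ) (hC : ∀ x ∈ Set.Ioc (0 : ℝ) 1, |F x| ≤ C * x) :
    Integrable F m :=
  (h.integrable_id.const_mul C).mono' hF.aestronglyMeasurable (h.ae_mem.mono hC)

/-- The bound is uniform in `m` because the points sum to one, even though `m` may have infinite
mass near 0. Both comparisons of topologies rest on it. -/
theorem IsMpOne.abs_integral_sub_le {m : Measure ℝ} (h : IsMpOne m) {F G : ℝ → ℝ}
    (hF : Integrable F m) (hG : Integrable G m) {ε : ℝ}
    (hε : ∀ x ∈ Set.Ioc (0 : ℝ) 1, |F x - G x| ≤ ε * x) :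
    |∫ x, F x ∂m - ∫ x, G x ∂m| ≤ ε := by
  rw [← integral_sub hF hG]
  refine (abs_integral_le_integral_abs).trans ?_
  refine (integral_mono_ae (hF.sub hG).abs (h.integrable_id.const_mul ε)
    (h.ae_mem.mono hε)).trans ?_
  rw [integral_const_mul, h.integral_id, mul_one]

/-- The power sums `∑ i, x i ^ (k + 1)`, `k ∈ ℕ`, of a mass-partition `∑ i, δ_{x i}`. -/
def powerSums (m : MassPartition) (k : ℕ) : ℝ := ∫ x, x ^ (k + 1) ∂m.toMeasure

theorem IsMpOne.integrable_pow {m : Measure ℝ} (h : IsMpOne m) (k : ℕ) :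
    Integrable (fun x => x ^ (k + 1)) m := by
  refine h.integrable_of_abs_le (by fun_prop) 1 fun x hx => ?_
  rw [abs_of_nonneg (pow_nonneg hx.1.le _), pow_succ]
  exact mul_le_mul_of_nonneg_right (pow_le_one₀ hx.1.le hx.2) hx.1.le

theorem TestFunction.integrable (f : TestFunction) {m : Measure ℝ} (h : IsMpOne m) :
    Integrable f.1 m := by
  obtain ⟨f, r, hr, hf⟩ := f
  refine h.integrable_of_abs_le f.continuous (‖f‖ / r) fun x hx => ?_
  rcases le_or_gt x r with hxr | hxr
  · rw [hf x hxr, abs_zero]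
    have := hx.1
    positivity
  · refine (f.norm_coe_le_norm x).trans ?_
    rw [div_mul_eq_mul_div, le_div_iff₀ hr]
    exact mul_le_mul_of_nonneg_left hxr.le (norm_nonneg f)

theorem continuous_integral_testFunction (f : TestFunction) :
    Continuous fun m : MassPartition => ∫ x, f.1 x ∂m.toMeasure := by
  have h : Continuous fun (m : MassPartition) (f : TestFunction) => ∫ x, f.1 x ∂m.toMeasure :=
    continuous_induced_dom
  exact (continuous_apply f).comp h

/-- The truncations `x ^ k (x - ε)⁺` of `x ^ (k + 1)`, made bounded. -/
def truncPow (k : ℕ) (ε : ℝ) (hε : 0 < ε) : TestFunction :=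
  ⟨BoundedContinuousFunction.ofNormedAddCommGroup
    (fun x => (max 0 (min x 1)) ^ k * max 0 (min x 1 - ε)) (by fun_prop) 1 fun x => by
      have h1 : max 0 (min x 1) ≤ 1 := by simp
      have h2 : max 0 (min x 1 - ε) ≤ 1 :=
        max_le zero_le_one (by linarith [min_le_right x 1])
      rw [Real.norm_of_nonneg (by positivity)]
      exact mul_le_one₀ (pow_le_one₀ (le_max_left _ _) h1) (le_max_left _ _) h2,
    ε, hε, fun x hx => by
      have : max 0 (min x 1 - ε) = 0 := max_eq_left (by linarith [min_le_left x 1])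
      simp [this]⟩

theorem continuous_powerSums : Continuous powerSums := by
  refine continuous_pi fun k => ?_
  rcases Nat.eq_zero_or_pos k with rfl | hk
  -- The truncation error is at most (ε/2) x^k, and this is at most (ε/2) x only for k ≥ 1. For k =
  -- 0 the power sum is constant instead.
  · have : (fun m : MassPartition => powerSums m 0) = fun _ => 1 := by
      ext m
      simpa [powerSums] using m.isMpOne.integral_id
    rw [this]
    exact continuous_const
  refine continuous_of_uniform_approx_of_continuous fun u hu => ?_
  obtain ⟨ε, hε, hu⟩ := Metric.mem_uniformity_dist.1 hu
  refine ⟨_, continuous_integral_testFunction (truncPow k (ε / 2) (half_pos hε)), fun m => hu ?_⟩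
  rw [Real.dist_eq]
  refine (m.isMpOne.abs_integral_sub_le (m.isMpOne.integrable_pow k)
    (TestFunction.integrable _ m.isMpOne) (ε := ε / 2) fun x hx => ?_).trans_lt (half_lt_self hε)
  change |x ^ (k + 1) - (max 0 (min x 1)) ^ k * max 0 (min x 1 - ε / 2)| ≤ _
  rw [min_eq_left hx.2, max_eq_right hx.1.le, pow_succ, ← mul_sub, abs_mul,
    abs_of_nonneg (pow_nonneg hx.1.le k), mul_comm]
  have h1 : |x - max 0 (x - ε / 2)| ≤ ε / 2 := by
    rw [abs_le]
    rcases max_cases 0 (x - ε / 2) with h | h <;> constructor <;> linarith [hx.1]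
  exact mul_le_mul h1 (pow_le_of_le_one hx.1.le hx.2 hk.ne') (pow_nonneg hx.1.le k) (half_pos hε).le

theorem integral_mul_polynomial (m : MassPartition) (p : Polynomial ℝ) :
    ∫ x, x * p.eval x ∂m.toMeasure = ∑ i ∈ Finset.range (p.natDegree + 1),
      p.coeff i * powerSums m i := by
  simp_rw [Polynomial.eval_eq_sum_range, Finset.mul_sum, powerSums, ← integral_const_mul]
  rw [integral_finsetSum _ fun i _ => ?_]
  · simp_rw [pow_succ]
    refine Finset.sum_congr rfl fun i _ => integral_congr_ae (ae_of_all _ fun x => ?_)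
    ring
  · refine ((m.isMpOne.integrable_pow i).const_mul (p.coeff i)).congr (ae_of_all _ fun x => ?_)
    simp only
    ring

/-- The vague topology on mass-partitions is generated by the power sums. -/
theorem isInducing_powerSums : Topology.IsInducing powerSums := by
  refine ⟨le_antisymm continuous_powerSums.le_induced ?_⟩
  refine continuous_iff_le_induced.1 (@continuous_pi _ _ _ (_) _ _ fun f => ?_)
  let τ : TopologicalSpace MassPartition := .induced powerSums inferInstance
  have hτ : @Continuous _ _ τ _ powerSums := continuous_induced_dom
  change @Continuous _ _ τ _ _
  refine @continuous_of_uniform_approx_of_continuous _ _ τ _ _ fun u hu => ?_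
  obtain ⟨ε, hε, hu⟩ := Metric.mem_uniformity_dist.1 hu
  obtain ⟨f, r, hr, hf⟩ := f
  -- Since `f` vanishes up to `r`, the quotient f(x)/x extends continuously to 0; the maximum with
  -- `r` realizes this. If p is ε/2-close to the quotient on [0,1], then x p(x) differs from f(x) by
  -- at most (ε/2)x and integrates to a linear combination of power sums.
  have hg : Continuous fun x => f x / max x r :=
    f.continuous.div (by fun_prop) fun x => (hr.trans_le (le_max_right x r)).ne'
  obtain ⟨p, hp⟩ := exists_polynomial_near_of_continuousOn 0 1 _ hg.continuousOn (ε / 2)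
    (half_pos hε)
  refine ⟨fun m => ∫ x, x * p.eval x ∂m.toMeasure, ?_, fun m => hu ?_⟩
  · simp_rw [integral_mul_polynomial]
    have hc : Continuous fun v : ℕ → ℝ =>
      ∑ i ∈ Finset.range (p.natDegree + 1), p.coeff i * v i := by fun_prop
    exact hc.comp hτ
  · rw [Real.dist_eq]
    have hint : Integrable (fun x => x * p.eval x) m.toMeasure := by
      obtain ⟨C, hC⟩ := (isCompact_Icc (a := (0 : ℝ)) (b := 1)).exists_bound_of_continuousOn
        p.continuous.continuousOn
      refine m.isMpOne.integrable_of_abs_le (continuous_id.mul p.continuous) C fun x hx => ?_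
      rw [abs_mul, abs_of_pos hx.1, mul_comm]
      exact mul_le_mul_of_nonneg_right (hC x ⟨hx.1.le, hx.2⟩) hx.1.le
    refine (m.isMpOne.abs_integral_sub_le (TestFunction.integrable ⟨f, r, hr, hf⟩ m.isMpOne)
      hint (ε := ε / 2) fun x hx => ?_).trans_lt (half_lt_self hε)
    have hfx : f x = x * (f x / max x r) := by
      rcases le_or_gt x r with hxr | hxr
      · simp [hf x hxr]
      · rw [max_eq_left hxr.le, mul_div_cancel₀ _ hx.1.ne']
    change |f x - _| ≤ _
    rw [hfx, ← mul_sub, abs_mul, abs_of_pos hx.1, mul_comm, abs_sub_comm]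
    exact mul_le_mul_of_nonneg_right (hp x ⟨hx.1.le, hx.2⟩).le hx.1.le

/-! ### Self-normalization in terms of power sums -/

/-- The power sum `∑ i, x i ^ (k + 1)` of `∑ i, δ_{x i}`, with values in `[0, ∞]`. -/
def powerMoment (m : Measure ℝ) (k : ℕ) : ℝ≥0∞ := ∫⁻ x, ENNReal.ofReal x ^ (k + 1) ∂m

theorem powerMoment_zero (m : Measure ℝ) : powerMoment m 0 = total m := by
  simp [powerMoment, total]

theorem measurable_powerMoment (k : ℕ) : Measurable fun m => powerMoment m k :=
  Measure.measurable_lintegral (by fun_prop)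

theorem powerSums_eq_toReal (m : MassPartition) (k : ℕ) :
    powerSums m k = (powerMoment m.toMeasure k).toReal := by
  have h := m.isMpOne.1.ae_pos
  rw [powerSums, integral_eq_lintegral_of_nonneg_ae (h.mono fun x hx => pow_nonneg hx.le _)
    (by fun_prop), powerMoment]
  congr 1
  exact lintegral_congr_ae (h.mono fun x hx => ENNReal.ofReal_pow hx.le _)

theorem IsMpOne.powerMoment_le_one {m : Measure ℝ} (h : IsMpOne m) (k : ℕ) :
    powerMoment m k ≤ 1 := by
  rw [← h.2]
  refine lintegral_mono_ae (h.ae_mem.mono fun x hx => ?_)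
  rw [pow_succ]
  exact mul_le_of_le_one_left' (pow_le_one' (by simpa using hx.2) k)

theorem powerMoment_normalize {m : Measure ℝ} (h : IsMpf m) (h0 : m ≠ 0) (k : ℕ) :
    powerMoment (normalize m) k = powerMoment m k / total m ^ (k + 1) := by
  have ht : 0 < (total m).toReal := ENNReal.toReal_pos (total_ne_zero h.1 h0) h.2.ne
  rw [powerMoment, normalize, lintegral_map (by fun_prop) (by fun_prop)]
  simp_rw [ENNReal.ofReal_div_of_pos ht, ENNReal.ofReal_toReal h.2.ne, div_eq_mul_inv, mul_pow]
  rw [lintegral_mul_const _ (by fun_prop), ENNReal.inv_pow]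
  rfl

theorem powerMoment_ne_top {m : Measure ℝ} (h : IsMpf m) (h0 : m ≠ 0) (k : ℕ) :
    powerMoment m k ≠ ∞ := by
  intro hk
  have h1 := (isMpOne_normalize h h0).powerMoment_le_one k
  rw [powerMoment_normalize h h0, hk, ENNReal.top_div_of_ne_top (by simp [h.2.ne])] at h1
  simp at h1

theorem selfNormalize_toMeasure {m : Measure ℝ} (h : IsMpf m) (h0 : m ≠ 0) :
    (selfNormalize m).toMeasure = normalize m := by
  rw [selfNormalize, dif_pos ⟨h, h0⟩]

/-- The numbers `exp (-∑ i, x i ^ (k + 1))`, `k ∈ ℕ`, as a point of the Hilbert cube. -/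
def expMoment (m : Measure ℝ) (k : ℕ) : unitInterval :=
  ⟨(expNeg (powerMoment m k)).toReal, ENNReal.toReal_nonneg,
    ENNReal.toReal_le_of_le_ofReal zero_le_one (by simpa using expNeg_le_one _)⟩

theorem coe_expMoment {m : Measure ℝ} (h : IsMpf m) (h0 : m ≠ 0) (k : ℕ) :
    (expMoment m k : ℝ) = Real.exp (-(powerMoment m k).toReal) :=
  expNeg_toReal (powerMoment_ne_top h h0 k)

theorem measurable_expMoment : Measurable expMoment :=
  measurable_pi_lambda _ fun k => Measurable.subtype_mk <|
    (measurable_expNeg.comp (measurable_powerMoment k)).ennreal_toReal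

/-- The power sums of the self-normalization as a function of `expMoment`. -/
def normalizedPower (y : ℕ → unitInterval) (k : ℕ) : ℝ :=
  -Real.log (y k) / (-Real.log (y 0)) ^ (k + 1)

/-- The points of the Hilbert cube at which `normalizedPower` is well-behaved. -/
def regularPoints : Set (ℕ → unitInterval) := {y | (∀ k, (y k : ℝ) ≠ 0) ∧ (y 0 : ℝ) ≠ 1}

theorem powerSums_selfNormalize {m : Measure ℝ} (h : IsMpf m) (h0 : m ≠ 0) :
    powerSums (selfNormalize m) = normalizedPower (expMoment m) := by
  ext k
  rw [powerSums_eq_toReal, selfNormalize_toMeasure h h0, powerMoment_normalize h h0,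
    normalizedPower, coe_expMoment h h0, coe_expMoment h h0, ENNReal.toReal_div, ENNReal.toReal_pow,
    powerMoment_zero]
  simp

theorem expMoment_mem_regularPoints {m : Measure ℝ} (h : IsMpf m) (h0 : m ≠ 0) :
    expMoment m ∈ regularPoints := by
  refine ⟨fun k => ?_, ?_⟩
  · rw [coe_expMoment h h0]
    exact (Real.exp_pos _).ne'
  · have := ENNReal.toReal_pos (total_ne_zero h.1 h0) h.2.ne
    rw [coe_expMoment h h0, powerMoment_zero, Ne, Real.exp_eq_one_iff]
    linarith

theorem continuousOn_normalizedPower : ContinuousOn normalizedPower regularPoints := by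
  refine continuousOn_pi.2 fun k => ?_
  refine ContinuousOn.div ?_ ?_ fun y hy => pow_ne_zero _ (neg_ne_zero.2 ?_)
  · exact (ContinuousOn.log (by fun_prop) fun y hy => hy.1 k).neg
  · exact (ContinuousOn.log (by fun_prop) fun y hy => hy.1 0).neg.pow _
  · have h0 := (y 0).2.1
    exact Real.log_ne_zero_of_pos_of_ne_one (lt_of_le_of_ne h0 (hy.1 0).symm) hy.2

theorem measurable_normalizedPower : Measurable normalizedPower := by
  refine measurable_pi_lambda _ fun k => ?_
  unfold normalizedPower
  fun_prop

/-- `normalizedPower` is continuous only on `regularPoints`, so the preimage of an open set is the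
trace of some open `W` there. This is enough, as admissible measures are sent into `regularPoints`.
-/
theorem exists_isOpen_expMoment {U : Set MassPartition} (hU : IsOpen U) :
    ∃ W : Set (ℕ → unitInterval), IsOpen W ∧
      ∀ m, IsMpf m → m ≠ 0 → (selfNormalize m ∈ U ↔ expMoment m ∈ W) := by
  obtain ⟨V, hV, rfl⟩ := isInducing_powerSums.isOpen_iff.1 hU
  obtain ⟨W, hW, hWV⟩ := continuousOn_iff'.1 continuousOn_normalizedPower V hV
  refine ⟨W, hW, fun m h h0 => ?_⟩
  have := Set.ext_iff.1 hWV (expMoment m)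
  simp only [Set.mem_inter_iff, expMoment_mem_regularPoints h h0, and_true,
    Set.mem_preimage] at this
  rw [← this, Set.mem_preimage, powerSums_selfNormalize h h0]

/-! ### Measurability -/

theorem measurable_iff_measurable_powerSums {Ω : Type*} [MeasurableSpace Ω]
    {S : Ω → MassPartition} : Measurable S ↔ Measurable fun ω => powerSums (S ω) := by
  have : (inferInstance : MeasurableSpace MassPartition)
      = MeasurableSpace.comap powerSums inferInstance := by
    change borel MassPartition = _
    rw [isInducing_powerSums.eq_induced, BorelSpace.measurable_eq (α := ℕ → ℝ), borel_comap]
  change _ ↔ Measurable (powerSums ∘ S)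
  rw [← measurable_comap_iff, ← this]

/-- Nothing is known about `S` on the exceptional null set, so `S` is replaced by a constant
partition on a measurable null set containing it. -/
theorem aemeasurable_of_powerSums {Ω : Type*} [MeasurableSpace Ω] {P : Measure Ω}
    {S : Ω → MassPartition} {g : Ω → ℕ → ℝ} (hg : AEMeasurable g P)
    (h : ∀ᵐ ω ∂P, powerSums (S ω) = g ω) : AEMeasurable S P := by
  classical
  have h' : ∀ᵐ ω ∂P, powerSums (S ω) = hg.mk g ω := by
    filter_upwards [h, hg.ae_eq_mk] with ω h1 h2 using h1.trans h2
  obtain ⟨t, hst, ht, hPt⟩ := exists_measurable_superset_of_null (ae_iff.1 h')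
  let c : MassPartition := ⟨_, isMpOne_dirac⟩
  refine ⟨t.piecewise (fun _ => c) S, ?_, ?_⟩
  · rw [measurable_iff_measurable_powerSums]
    have hpw : (fun ω => powerSums (t.piecewise (fun _ => c) S ω))
        = t.piecewise (fun _ => powerSums c) (hg.mk g) := ?_
    · rw [hpw]
      exact Measurable.piecewise ht measurable_const hg.measurable_mk
    ext1 ω
    by_cases hω : ω ∈ t
    · simp [hω]
    · have : powerSums (S ω) = hg.mk g ω := by
        by_contra hne
        exact hω (hst hne)
      simp [hω, this]
  · filter_upwards [measure_eq_zero_iff_ae_notMem.1 hPt] with ω hω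
    simp [hω]

theorem aemeasurable_selfNormalize {Ω : Type*} [MeasurableSpace Ω] {P : Measure Ω}
    {X : Ω → Measure ℝ} (hX : AEMeasurable X P) (hgood : ∀ᵐ ω ∂P, IsMpf (X ω) ∧ X ω ≠ 0) :
    AEMeasurable (fun ω => selfNormalize (X ω)) P :=
  aemeasurable_of_powerSums
    ((measurable_normalizedPower.comp measurable_expMoment).comp_aemeasurable hX)
    (hgood.mono fun _ h => powerSums_selfNormalize h.1 h.2)

/-! ### Convergence in distribution on the Hilbert cube -/

/-- Coordinate functions on the Hilbert cube. -/
def cubeCoord (k : ℕ) : C(ℕ → unitInterval, ℝ) := ⟨fun y => y k, by fun_prop⟩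

theorem exists_aeval_cubeCoord_near (f : C(ℕ → unitInterval, ℝ)) {ε : ℝ} (hε : 0 < ε) :
    ∃ p : MvPolynomial ℕ ℝ, ‖MvPolynomial.aeval cubeCoord p - f‖ < ε := by
  obtain ⟨⟨_, p, rfl⟩, hp⟩ :=
    ContinuousMap.exists_mem_subalgebra_near_continuousMap_of_separatesPoints
      (MvPolynomial.aeval cubeCoord : MvPolynomial ℕ ℝ →ₐ[ℝ] C(ℕ → unitInterval, ℝ)).range
      (fun x y hxy => by
        obtain ⟨k, hk⟩ := Function.ne_iff.1 hxy
        refine ⟨cubeCoord k, ⟨cubeCoord k, ⟨MvPolynomial.X k, by simp⟩, rfl⟩, ?_⟩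
        simpa [cubeCoord, Subtype.ext_iff] using hk) f ε hε
  exact ⟨p, hp⟩

/-- Method of moments on a compact space: polynomials in the coordinates are uniformly dense, and a
uniform error passes unchanged through integration against probability measures. -/
theorem tendsto_of_tendsto_monomials {ι : Type*} {l : Filter ι}
    {μ : ι → ProbabilityMeasure (ℕ → unitInterval)} {μ₀ : ProbabilityMeasure (ℕ → unitInterval)}
    (h : ∀ n : ℕ →₀ ℕ,
      Tendsto (fun i => ∫ y, n.prod (fun k e => (y k : ℝ) ^ e) ∂(μ i : Measure (ℕ → unitInterval)))
        l (𝓝 (∫ y, n.prod (fun k e => (y k : ℝ) ^ e) ∂(μ₀ : Measure (ℕ → unitInterval))))) :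
    Tendsto μ l (𝓝 μ₀) := by
  have hint : ∀ (f : C(ℕ → unitInterval, ℝ)) (ν : ProbabilityMeasure (ℕ → unitInterval)),
      Integrable f (ν : Measure (ℕ → unitInterval)) := fun f ν =>
    (BoundedContinuousFunction.mkOfCompact f).integrable _
  have hpoly : ∀ p : MvPolynomial ℕ ℝ, Tendsto
      (fun i => ∫ y, MvPolynomial.aeval cubeCoord p y ∂(μ i : Measure (ℕ → unitInterval))) l
      (𝓝 (∫ y, MvPolynomial.aeval cubeCoord p y ∂(μ₀ : Measure (ℕ → unitInterval)))) := by
    intro p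
    induction p using MvPolynomial.induction_on' with
    | monomial n a =>
      have h1 : ∀ y, MvPolynomial.aeval cubeCoord (MvPolynomial.monomial n a) y
          = a * n.prod (fun k e => (y k : ℝ) ^ e) := fun y => by
        rw [MvPolynomial.aeval_monomial, ContinuousMap.mul_apply, Finsupp.prod, Finsupp.prod,
          ContinuousMap.prod_apply]
        rfl
      simp_rw [h1, integral_const_mul]
      exact (h n).const_mul a
    | add p q hp hq =>
      simp_rw [map_add, ContinuousMap.add_apply]
      simp_rw [integral_add (hint _ _) (hint _ _)]
      exact hp.add hq
  rw [ProbabilityMeasure.tendsto_iff_forall_integral_tendsto]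
  intro f
  have hle : ∀ (p : MvPolynomial ℕ ℝ) (ν : ProbabilityMeasure (ℕ → unitInterval)),
      |∫ y, f y ∂(ν : Measure (ℕ → unitInterval))
        - ∫ y, MvPolynomial.aeval cubeCoord p y ∂(ν : Measure (ℕ → unitInterval))|
      ≤ ‖MvPolynomial.aeval cubeCoord p - f.toContinuousMap‖ := fun p ν => by
    have hf : Integrable f (ν : Measure (ℕ → unitInterval)) := hint f.toContinuousMap ν
    rw [abs_sub_comm, ← integral_sub (hint _ _) hf]
    have := norm_integral_le_of_norm_le_const (μ := (ν : Measure (ℕ → unitInterval)))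
      (ae_of_all _ fun y => ContinuousMap.norm_coe_le_norm
        (MvPolynomial.aeval cubeCoord p - f.toContinuousMap) y)
    rwa [probReal_univ, mul_one] at this
  rw [Metric.tendsto_nhds]
  intro ε hε
  obtain ⟨p, hp⟩ := exists_aeval_cubeCoord_near f.toContinuousMap (ε := ε / 3) (by positivity)
  filter_upwards [Metric.tendsto_nhds.1 (hpoly p) (ε / 3) (by positivity)] with i hi
  rw [Real.dist_eq] at hi ⊢
  have h1 := abs_le.1 ((hle p (μ i)).trans hp.le)
  have h2 := abs_le.1 ((hle p μ₀).trans hp.le)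
  have h3 := abs_lt.1 hi
  rw [abs_lt]
  constructor <;> linarith [h1.1, h1.2, h2.1, h2.2, h3.1, h3.2]

/-! ### Convergence of self-normalized random measures via Laplace functionals -/

/-- The functions `x ↦ ∑ k, n k * x ^ (k + 1)`. -/
def powerTest (n : ℕ →₀ ℕ) (x : ℝ) : ℝ≥0∞ :=
  n.sum fun k e => (e : ℝ≥0∞) * ENNReal.ofReal x ^ (k + 1)

theorem continuous_powerTest (n : ℕ →₀ ℕ) : Continuous (powerTest n) := by
  refine continuous_finsetSum _ fun k _ => ENNReal.continuous_const_mul (by simp) |>.comp ?_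
  exact (ENNReal.continuous_pow _).comp ENNReal.continuous_ofReal

theorem lintegral_powerTest (n : ℕ →₀ ℕ) (m : Measure ℝ) :
    ∫⁻ x, powerTest n x ∂m = n.sum fun k e => (e : ℝ≥0∞) * powerMoment m k := by
  simp only [powerTest, Finsupp.sum]
  rw [lintegral_finsetSum _ (by fun_prop)]
  exact Finset.sum_congr rfl fun k _ => lintegral_const_mul _ (by fun_prop)

/-- A monomial in exponentials is the exponential of a linear combination, so each mixed moment is
one value of the Laplace functional. -/
theorem integral_expMoment_prod {Ω : Type*} [MeasurableSpace Ω] {P : Measure Ω}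
    {X : Ω → Measure ℝ} (hX : AEMeasurable X P) (n : ℕ →₀ ℕ) :
    ∫ y, n.prod (fun k e => (y k : ℝ) ^ e) ∂(P.map fun ω => expMoment (X ω))
      = (∫⁻ ω, expNeg (∫⁻ x, powerTest n x ∂X ω) ∂P).toReal := by
  have hm : Measurable fun m : Measure ℝ => expNeg (∫⁻ x, powerTest n x ∂m) :=
    measurable_expNeg.comp (Measure.measurable_lintegral (continuous_powerTest n).measurable)
  have hY : AEMeasurable (fun ω => expMoment (X ω)) P := measurable_expMoment.comp_aemeasurable hX
  rw [integral_map hY, ← integral_toReal]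
  · refine integral_congr_ae (ae_of_all _ fun ω => ?_)
    simp only [lintegral_powerTest, Finsupp.sum, Finsupp.prod, expNeg_sum, expNeg_nat_mul,
      ENNReal.toReal_prod, ENNReal.toReal_pow]
    rfl
  · exact hm.comp_aemeasurable hX
  · exact ae_of_all _ fun ω => (expNeg_ne_top _).lt_top
  · simp only [Finsupp.prod]
    exact Measurable.aestronglyMeasurable (by fun_prop)

theorem tendstoInDistribution_selfNormalize {ι : Type*} {Ω : ι → Type*}
    [∀ i, MeasurableSpace (Ω i)] {P : ∀ i, Measure (Ω i)} [∀ i, IsProbabilityMeasure (P i)]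
    {Ω₀ : Type*} [MeasurableSpace Ω₀] {P₀ : Measure Ω₀} [IsProbabilityMeasure P₀]
    {l : Filter ι} [l.IsCountablyGenerated] {X : ∀ i, Ω i → Measure ℝ} {X₀ : Ω₀ → Measure ℝ}
    (hX : ∀ i, AEMeasurable (X i) (P i)) (hX₀ : AEMeasurable X₀ P₀)
    (hgood : ∀ i, ∀ᵐ ω ∂P i, IsMpf (X i ω) ∧ X i ω ≠ 0)
    (hgood₀ : ∀ᵐ ω ∂P₀, IsMpf (X₀ ω) ∧ X₀ ω ≠ 0)
    (hlim : ∀ n : ℕ →₀ ℕ, Tendsto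
      (fun i => ∫⁻ ω, expNeg (∫⁻ x, powerTest n x ∂X i ω) ∂P i) l
      (𝓝 (∫⁻ ω, expNeg (∫⁻ x, powerTest n x ∂X₀ ω) ∂P₀))) :
    TendstoInDistribution (fun i ω => selfNormalize (X i ω)) l
      (fun ω => selfNormalize (X₀ ω)) P P₀ := by
  have hY : ∀ i, AEMeasurable (fun ω => expMoment (X i ω)) (P i) := fun i =>
    measurable_expMoment.comp_aemeasurable (hX i)
  have hY₀ : AEMeasurable (fun ω => expMoment (X₀ ω)) P₀ :=
    measurable_expMoment.comp_aemeasurable hX₀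
  have hS := fun i => aemeasurable_selfNormalize (hX i) (hgood i)
  have hS₀ := aemeasurable_selfNormalize hX₀ hgood₀
  refine ⟨hS, hS₀, ?_⟩
  have hcube : Tendsto (β := ProbabilityMeasure (ℕ → unitInterval))
      (fun i => ⟨(P i).map fun ω => expMoment (X i ω), Measure.isProbabilityMeasure_map (hY i)⟩) l
      (𝓝 ⟨P₀.map fun ω => expMoment (X₀ ω), Measure.isProbabilityMeasure_map hY₀⟩) := by
    refine tendsto_of_tendsto_monomials fun n => ?_
    simp only [ProbabilityMeasure.coe_mk]
    simp_rw [fun i => integral_expMoment_prod (hX i) n]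
    rw [integral_expMoment_prod hX₀ n]
    refine (ENNReal.tendsto_toReal ?_).comp (hlim n)
    refine ne_top_of_le_ne_top ENNReal.one_ne_top
      ((lintegral_mono fun ω => expNeg_le_one _).trans (by simp))
  -- The open-set form of the portmanteau theorem suits this setting: almost surely, membership in
  -- `U` is membership of the cube point in an open `W`.
  refine tendsto_of_forall_isOpen_le_liminf' fun U hU => ?_
  obtain ⟨W, hW, hUW⟩ := exists_isOpen_expMoment hU
  have h1 : ∀ i, (P i).map (fun ω => selfNormalize (X i ω)) U
      = (P i).map (fun ω => expMoment (X i ω)) W := fun i => by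
    rw [Measure.map_apply_of_aemeasurable (hS i) hU.measurableSet,
      Measure.map_apply_of_aemeasurable (hY i) hW.measurableSet]
    exact measure_congr ((hgood i).mono fun ω h => propext (hUW _ h.1 h.2))
  have h2 : P₀.map (fun ω => selfNormalize (X₀ ω)) U = P₀.map (fun ω => expMoment (X₀ ω)) W := by
    rw [Measure.map_apply_of_aemeasurable hS₀ hU.measurableSet,
      Measure.map_apply_of_aemeasurable hY₀ hW.measurableSet]
    exact measure_congr (hgood₀.mono fun ω h => propext (hUW _ h.1 h.2))
  have := ProbabilityMeasure.le_liminf_measure_open_of_tendsto hcube hW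
  simp only [ProbabilityMeasure.coe_mk] at this ⊢
  simp_rw [h1, h2]
  exact this

/-! ### The intensity measures -/

instance : SFinite lebPos := by
  unfold lebPos
  infer_instance

instance : SFinite gammaLevy := by
  unfold gammaLevy
  infer_instance

instance (α : ℝ) : SFinite (stableLevy α) := by
  unfold stableLevy
  infer_instance

/-- The density of `jumpIntensity`. -/
def jumpDensity (θ α x : ℝ) : ℝ := θ / Real.Gamma (1 - α) * (x ^ (-α - 1) * Real.exp (-x))

/-- The measure `θ / Γ(1-α) · x^{-(α+1)} e^{-x} dx` on `(0,∞)`. -/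
def jumpIntensity (θ α : ℝ) : Measure ℝ :=
  lebPos.withDensity fun x => ENNReal.ofReal (jumpDensity θ α x)

theorem measurable_jumpDensity (θ α : ℝ) :
    Measurable fun x => ENNReal.ofReal (jumpDensity θ α x) := by
  unfold jumpDensity
  fun_prop

theorem jumpDensity_nonneg {θ α x : ℝ} (hθ : 0 < θ) (hα : α < 1) (hx : 0 < x) :
    0 ≤ jumpDensity θ α x := by
  have := Real.Gamma_pos_of_pos (sub_pos.2 hα)
  unfold jumpDensity
  positivity

theorem lintegral_lebPos_congr {f g : ℝ → ℝ≥0∞} (h : ∀ x, 0 < x → f x = g x) :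
    ∫⁻ x, f x ∂lebPos = ∫⁻ x, g x ∂lebPos :=
  setLIntegral_congr_fun measurableSet_Ioi fun x hx => h x hx

theorem ae_lebPos {p : ℝ → Prop} (h : ∀ x, 0 < x → p x) : ∀ᵐ x ∂lebPos, p x :=
  (ae_restrict_mem measurableSet_Ioi).mono fun x hx => h x hx

theorem lintegral_jumpIntensity (θ α : ℝ) {f : ℝ → ℝ≥0∞} (hf : Measurable f) :
    ∫⁻ x, f x ∂jumpIntensity θ α = ∫⁻ x, ENNReal.ofReal (jumpDensity θ α x) * f x ∂lebPos :=
  lintegral_withDensity_eq_lintegral_mul _ (measurable_jumpDensity θ α) hf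

theorem jumpIntensity_Iic_zero (θ α : ℝ) : jumpIntensity θ α (Set.Iic 0) = 0 := by
  refine withDensity_absolutelyContinuous _ _ ?_
  rw [lebPos, Measure.restrict_apply measurableSet_Iic, Set.Iic_inter_Ioi, Set.Ioc_self,
    measure_empty]

theorem powerMoment_jumpIntensity_ne_top {θ α : ℝ} (hθ : 0 < θ) (hα : α < 1) (k : ℕ) :
    powerMoment (jumpIntensity θ α) k ≠ ∞ := by
  rw [powerMoment, lintegral_jumpIntensity _ _ (by fun_prop)]
  have hk : (0 : ℝ) ≤ k := k.cast_nonneg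
  have h : IntegrableOn (fun x : ℝ => θ / Real.Gamma (1 - α)
      * (Real.exp (-x) * x ^ ((k + 1 - α) - 1))) (Set.Ioi 0) :=
    (Real.GammaIntegral_convergent (by linarith)).const_mul _
  refine ne_of_eq_of_ne (lintegral_lebPos_congr fun x hx => ?_) h.lintegral_lt_top.ne
  rw [← ENNReal.ofReal_pow hx.le, ← ENNReal.ofReal_mul (jumpDensity_nonneg hθ hα hx), jumpDensity]
  congr 1
  have : (k + 1 - α) - 1 = (-α - 1) + ((k + 1 : ℕ) : ℝ) := by push_cast; ring
  rw [this, Real.rpow_add hx, Real.rpow_natCast]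
  ring

theorem jumpIntensity_univ {θ α : ℝ} (hθ : 0 < θ) (hα0 : 0 ≤ α) (hα : α < 1) :
    jumpIntensity θ α Set.univ = ∞ := by
  have hΓ := Real.Gamma_pos_of_pos (sub_pos.2 hα)
  -- On (0,1) one has x^{-α-1} ≥ x^{-1} and e^{-x} ≥ e^{-1}, so the density dominates c/x, which is
  -- not integrable at 0.
  set c := θ / Real.Gamma (1 - α) * Real.exp (-1) with hc
  have hc0 : 0 < c := by positivity
  have h1 : ∫⁻ x in Set.Ioo (0 : ℝ) 1, ENNReal.ofReal (x ^ (-1 : ℝ)) = ∞ := by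
    by_contra hne
    have : IntegrableOn (fun x : ℝ => x ^ (-1 : ℝ)) (Set.Ioo 0 1) := by
      refine ⟨by fun_prop, ?_⟩
      rw [hasFiniteIntegral_iff_ofReal]
      · exact lt_top_iff_ne_top.2 hne
      · filter_upwards [ae_restrict_mem measurableSet_Ioo] with x hx
        exact Real.rpow_nonneg hx.1.le _
    rw [intervalIntegral.integrableOn_Ioo_rpow_iff one_pos] at this
    exact lt_irrefl _ this
  have h2 : ∫⁻ x in Set.Ioo (0 : ℝ) 1, ENNReal.ofReal c * ENNReal.ofReal (x ^ (-1 : ℝ)) = ∞ := by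
    rw [lintegral_const_mul _ (by fun_prop), h1, ENNReal.mul_top (by simpa using hc0)]
  rw [eq_top_iff, ← h2, ← setLIntegral_one, Measure.restrict_univ,
    lintegral_jumpIntensity _ _ measurable_const]
  refine (setLIntegral_mono' (g := fun x => ENNReal.ofReal (jumpDensity θ α x) * 1)
    measurableSet_Ioo fun x hx => ?_).trans (lintegral_mono_set Set.Ioo_subset_Ioi_self)
  rw [mul_one, ← ENNReal.ofReal_mul hc0.le]
  refine ENNReal.ofReal_le_ofReal ?_
  rw [hc, jumpDensity, mul_assoc]
  refine mul_le_mul_of_nonneg_left ?_ (by positivity)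
  rw [mul_comm]
  refine mul_le_mul ?_ ?_ (by positivity) (Real.rpow_nonneg hx.1.le _)
  · exact Real.rpow_le_rpow_of_exponent_ge hx.1 hx.2.le (by linarith)
  · exact Real.exp_le_exp.2 (by linarith [hx.2])

/-- A majorant free of α for dominated convergence: x^{-α-1} is at most x^{-3/2} for x ≤ 1 and at
most x^{-1} for x ≥ 1. The factor Γ(1/2) cancels the normalization of the density at exponent 1/2.
-/
theorem jumpDensity_le {θ α x : ℝ} (hθ : 0 < θ) (hα0 : 0 ≤ α) (hα : α ≤ 1 / 2)
    (hΓ : 1 / 2 ≤ Real.Gamma (1 - α)) (hx : 0 < x) :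
    jumpDensity θ α x ≤ 2 * jumpDensity θ 0 x
      + 2 * Real.Gamma (1 - 1 / 2) * jumpDensity θ (1 / 2) x := by
  have hΓ' : 0 < Real.Gamma (1 - 1 / 2) := Real.Gamma_pos_of_pos (by norm_num)
  have h1 : θ / Real.Gamma (1 - α) ≤ 2 * θ := by
    rw [div_le_iff₀ (by linarith)]
    nlinarith
  have h2 : x ^ (-α - 1) ≤ x ^ (-0 - 1 : ℝ) + x ^ (-(1 / 2) - 1 : ℝ) := by
    have ha := Real.rpow_nonneg hx.le (-0 - 1 : ℝ)
    have hb := Real.rpow_nonneg hx.le (-(1 / 2) - 1 : ℝ)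
    rcases le_total x 1 with h | h
    · exact (Real.rpow_le_rpow_of_exponent_ge hx h (show -(1 / 2 : ℝ) - 1 ≤ -α - 1 by linarith)).trans
        (le_add_of_nonneg_left ha)
    · exact (Real.rpow_le_rpow_of_exponent_le h (show -α - 1 ≤ (-0 - 1 : ℝ) by linarith)).trans
        (le_add_of_nonneg_right hb)
  calc jumpDensity θ α x
      ≤ 2 * θ * ((x ^ (-0 - 1 : ℝ) + x ^ (-(1 / 2) - 1 : ℝ)) * Real.exp (-x)) := by
        unfold jumpDensity
        gcongr
    _ = _ := by
        unfold jumpDensity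
        rw [sub_zero, Real.Gamma_one]
        field_simp

/-- The Laplace exponents converge as `α → 0`. -/
theorem tendsto_lintegral_jumpIntensity {θ : ℝ} (hθ : 0 < θ) {f : ℝ → ℝ≥0∞} (hf : Measurable f)
    (h0 : ∫⁻ x, f x ∂jumpIntensity θ 0 ≠ ∞) (h1 : ∫⁻ x, f x ∂jumpIntensity θ (1 / 2) ≠ ∞) :
    Tendsto (fun α : Set.Ioo (0 : ℝ) 1 => ∫⁻ x, (1 - expNeg (f x)) ∂jumpIntensity θ α)
      (comap (fun α : Set.Ioo (0 : ℝ) 1 => (α : ℝ)) (𝓝 0))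
      (𝓝 (∫⁻ x, (1 - expNeg (f x)) ∂jumpIntensity θ 0)) := by
  have hg : Measurable fun x => 1 - expNeg (f x) := continuous_one_sub_expNeg.measurable.comp hf
  have hcoe : Tendsto (fun α : Set.Ioo (0 : ℝ) 1 => (α : ℝ))
      (comap (fun α : Set.Ioo (0 : ℝ) 1 => (α : ℝ)) (𝓝 0)) (𝓝 0) := tendsto_comap
  have hΓc : Tendsto (fun α : ℝ => Real.Gamma (1 - α)) (𝓝 0) (𝓝 1) := by
    have h : ContinuousAt Real.Gamma (1 - 0) := by
      refine (Real.differentiableAt_Gamma fun m => ?_).continuousAt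
      have : (0 : ℝ) ≤ m := m.cast_nonneg
      linarith
    have h' : ContinuousAt (fun α : ℝ => Real.Gamma (1 - α)) 0 :=
      ContinuousAt.comp (f := fun α : ℝ => 1 - α) h (by fun_prop)
    simpa [ContinuousAt] using h'
  simp_rw [lintegral_jumpIntensity _ _ hg]
  refine tendsto_lintegral_filter_of_dominated_convergence
    (fun x => (2 * ENNReal.ofReal (jumpDensity θ 0 x)
      + ENNReal.ofReal (2 * Real.Gamma (1 - 1 / 2)) * ENNReal.ofReal (jumpDensity θ (1 / 2) x))
      * f x) (Eventually.of_forall fun α => (measurable_jumpDensity _ _).mul hg) ?_ ?_ ?_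
  · filter_upwards [hcoe.eventually (gt_mem_nhds (show (0 : ℝ) < 1 / 2 by norm_num)),
      (hΓc.comp hcoe).eventually (lt_mem_nhds (show (1 / 2 : ℝ) < 1 by norm_num))] with α hα hΓ
    refine ae_lebPos fun x hx => mul_le_mul' ?_ (one_sub_expNeg_le _)
    refine (ENNReal.ofReal_le_ofReal (jumpDensity_le hθ α.2.1.le hα.le hΓ.le hx)).trans ?_
    refine ENNReal.ofReal_add_le.trans ?_
    have hΓ' : 0 < Real.Gamma (1 - 1 / 2) := Real.Gamma_pos_of_pos (by norm_num)
    rw [ENNReal.ofReal_mul zero_le_two, ENNReal.ofReal_mul (by positivity)]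
    simp
  · simp_rw [add_mul, mul_assoc]
    have hm0 : Measurable fun x => ENNReal.ofReal (jumpDensity θ 0 x) * f x :=
      (measurable_jumpDensity θ 0).mul hf
    have hm1 : Measurable fun x => ENNReal.ofReal (jumpDensity θ (1 / 2) x) * f x :=
      (measurable_jumpDensity θ (1 / 2)).mul hf
    rw [lintegral_add_left (hm0.const_mul _), lintegral_const_mul _ hm0,
      lintegral_const_mul _ hm1, ← lintegral_jumpIntensity _ _ hf, ← lintegral_jumpIntensity _ _ hf]
    exact ENNReal.add_ne_top.2 ⟨ENNReal.mul_ne_top (by simp) h0,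
      ENNReal.mul_ne_top ENNReal.ofReal_ne_top h1⟩
  · refine ae_lebPos fun x hx => ?_
    refine ENNReal.Tendsto.mul_const ?_ (.inr (by simp))
    refine (ENNReal.continuous_ofReal.tendsto _).comp ?_
    have h : Tendsto (fun α : ℝ => jumpDensity θ α x) (𝓝 0) (𝓝 (jumpDensity θ 0 x)) := by
      unfold jumpDensity
      refine Tendsto.mul (tendsto_const_nhds.div ?_ ?_) (Tendsto.mul ?_ tendsto_const_nhds)
      · simpa using hΓc
      · simp
      · have : Continuous fun α : ℝ => x ^ (-α - 1) :=
          Real.continuous_const_rpow hx.ne' |>.comp (by fun_prop)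
        exact this.tendsto 0
    exact h.comp hcoe

theorem lintegral_powerTest_jumpIntensity_ne_top {θ α : ℝ} (hθ : 0 < θ) (hα : α < 1)
    (n : ℕ →₀ ℕ) : ∫⁻ x, powerTest n x ∂jumpIntensity θ α ≠ ∞ := by
  rw [lintegral_powerTest, Finsupp.sum, ENNReal.sum_ne_top]
  exact fun k _ => ENNReal.mul_ne_top (by simp) (powerMoment_jumpIntensity_ne_top hθ hα k)

/-! ### Random measures with a Laplace functional of Poisson type -/

/-- The Laplace functional of the random measure `X` agrees with that of a Poisson process with
intensity `ν` on continuous functions that are integrable with respect to `ν`. -/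
def HasPoissonLaplace {Ω : Type*} [MeasurableSpace Ω] (X : Ω → Measure ℝ) (ν : Measure ℝ)
    (P : Measure Ω) : Prop :=
  ∀ f : ℝ → ℝ≥0∞, Continuous f → ∫⁻ x, f x ∂ν ≠ ∞ →
    ∫⁻ ω, expNeg (∫⁻ x, f x ∂X ω) ∂P = expNeg (∫⁻ x, (1 - expNeg (f x)) ∂ν)

/-- With S the total, P(S < ∞) ≥ E e^{-εS} ≥ exp(-ε · `total ν`) for every ε > 0, and the right side
tends to 1 as ε → 0. -/
theorem HasPoissonLaplace.ae_total_lt_top {Ω : Type*} [MeasurableSpace Ω] {X : Ω → Measure ℝ}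
    {ν : Measure ℝ} {P : Measure Ω} [IsProbabilityMeasure P] (h : HasPoissonLaplace X ν P)
    (hX : AEMeasurable X P) (hν : total ν ≠ ∞) : ∀ᵐ ω ∂P, total (X ω) < ∞ := by
  have hmt : Measurable total := Measure.measurable_lintegral (by fun_prop)
  have hm : NullMeasurableSet {ω | total (X ω) < ∞} P :=
    (hmt.comp_aemeasurable hX).nullMeasurable (measurableSet_Iio (a := (∞ : ℝ≥0∞)))
  change {ω | total (X ω) < ∞} ∈ ae P
  rw [mem_ae_iff_prob_eq_one₀ hm]
  refine le_antisymm prob_le_one ?_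
  let ε : ℕ → ℝ≥0∞ := fun n => (n : ℝ≥0∞)⁻¹
  have hlim : Tendsto (fun n => expNeg (ε n * total ν)) atTop (𝓝 1) := by
    have h1 : Tendsto (fun n => ε n * total ν) atTop (𝓝 (0 * total ν)) :=
      ENNReal.Tendsto.mul_const ENNReal.tendsto_inv_nat_nhds_zero (.inr hν)
    rw [zero_mul] at h1
    rw [← expNeg_zero]
    exact (continuous_expNeg.tendsto 0).comp h1
  refine le_of_tendsto hlim ?_
  filter_upwards [eventually_gt_atTop 0] with n hn
  have hε : ε n ≠ ∞ := by simpa [ε] using hn.ne'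
  have hε0 : ε n ≠ 0 := by simp [ε]
  have hint : ∀ m : Measure ℝ, ∫⁻ x, ε n * ENNReal.ofReal x ∂m = ε n * total m := fun m =>
    lintegral_const_mul _ ENNReal.measurable_ofReal
  calc expNeg (ε n * total ν)
      ≤ expNeg (∫⁻ x, (1 - expNeg (ε n * ENNReal.ofReal x)) ∂ν) := by
        rw [← hint]
        exact expNeg_antitone (lintegral_mono fun x => one_sub_expNeg_le _)
    _ = ∫⁻ ω, expNeg (ε n * total (X ω)) ∂P := by
        rw [← h (fun x => ε n * ENNReal.ofReal x)
          ((ENNReal.continuous_const_mul hε).comp ENNReal.continuous_ofReal)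
          (by rw [hint]; exact ENNReal.mul_ne_top hε hν)]
        simp_rw [hint]
    _ ≤ ∫⁻ ω, {ω | total (X ω) < ∞}.indicator 1 ω ∂P := by
        refine lintegral_mono fun ω => ?_
        by_cases hω : total (X ω) < ∞
        · simpa [hω] using expNeg_le_one _
        · rw [not_lt, top_le_iff] at hω
          simp [hω, ENNReal.mul_top hε0]
    _ = P {ω | total (X ω) < ∞} := lintegral_indicator_one₀ hm

theorem isMpf_of_total {m : Measure ℝ} (hc : IsCounting m) (h0 : m (Set.Iic 0) = 0)
    (ht : total m < ∞) : IsMpf m := by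
  refine ⟨⟨hc, h0, fun u hu => ?_⟩, ht⟩
  have h1 := mul_meas_ge_le_lintegral (μ := m) ENNReal.measurable_ofReal (ENNReal.ofReal u)
  have hu' : ENNReal.ofReal u ≠ 0 := by simpa using hu
  have h2 : m {x | ENNReal.ofReal u ≤ ENNReal.ofReal x} ≠ ∞ := fun h => by
    rw [h, ENNReal.mul_top hu', top_le_iff] at h1
    exact ht.ne h1
  exact (measure_mono fun x hx => ENNReal.ofReal_le_ofReal (le_of_lt hx)).trans_lt h2.lt_top

/-! ### Restrictions and images of Poisson processes -/

theorem IsCounting.restrict {E : Type*} [MeasurableSpace E] {m : Measure E}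
    (h : IsCounting m) {C : Set E} (hC : MeasurableSet C) : IsCounting (m.restrict C) := by
  classical
  obtain ⟨ι, hι, x, rfl⟩ := h
  refine ⟨{i // x i ∈ C}, inferInstance, fun i => x i, ?_⟩
  ext B hB
  rw [Measure.restrict_apply hB, Measure.sum_apply _ (hB.inter hC), Measure.sum_apply _ hB,
    show ∑' i : {i // x i ∈ C}, Measure.dirac (x i) B = _ from
      tsum_subtype {i | x i ∈ C} fun i => Measure.dirac (x i) B]
  refine tsum_congr fun i => ?_
  by_cases hi : x i ∈ C <;> by_cases hi' : x i ∈ B <;>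
    simp [Measure.dirac_apply', hB, hB.inter hC, hi, hi']

/-- Counts of the new process are counts of `N` on g⁻¹(B) ∩ C. As the marks are coordinates of the
points, thinning is also of this form and needs no separate argument. -/
theorem IsPoissonProcess.restrict_map {Ω E F : Type*} [MeasurableSpace Ω] [MeasurableSpace E]
    [MeasurableSpace F] {N : Ω → Measure E} {μ : Measure E} {P : Measure Ω}
    (h : IsPoissonProcess N μ P) {C : Set E} (hC : MeasurableSet C) {g : E → F}
    (hg : Measurable g) :
    IsPoissonProcess (fun ω => ((N ω).restrict C).map g) ((μ.restrict C).map g) P := by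
  have key : ∀ (m : Measure E) (B : Set F), MeasurableSet B →
      (m.restrict C).map g B = m (g ⁻¹' B ∩ C) := fun m B hB => by
    rw [Measure.map_apply hg hB, Measure.restrict_apply (hg hB)]
  have hBC : ∀ B : Set F, MeasurableSet B → MeasurableSet (g ⁻¹' B ∩ C) := fun B hB =>
    (hg hB).inter hC
  refine ⟨?_, fun ω => ((h.counting ω).restrict hC).map hg, fun B hB => ?_, fun n B hB hd => ?_⟩
  · refine Measure.measurable_of_measurable_coe _ fun B hB => ?_
    simp_rw [key _ B hB]
    exact (Measure.measurable_coe (hBC B hB)).comp h.measurable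
  · simp_rw [key _ B hB]
    exact h.law_count _ (hBC B hB)
  · simp_rw [fun i ω => key (N ω) (B i) (hB i)]
    exact h.indep_count n _ (fun i => hBC _ (hB i)) fun i j hij =>
      ((hd hij).preimage g).mono Set.inter_subset_left Set.inter_subset_left

theorem IsPoissonProcess.ae_eq_zero {Ω E : Type*} [MeasurableSpace Ω] [MeasurableSpace E]
    {N : Ω → Measure E} {μ : Measure E} {P : Measure Ω} [IsProbabilityMeasure P]
    (h : IsPoissonProcess N μ P) {B : Set E} (hB : MeasurableSet B) (h0 : μ B = 0) :
    ∀ᵐ ω ∂P, N ω B = 0 := by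
  have hm : Measurable fun ω => N ω B := (Measure.measurable_coe hB).comp h.measurable
  have h1 : ∫⁻ ω, expNeg (N ω B) ∂P = 1 := by
    have h2 := lintegral_expNeg_poissonLaw (μ B) 1
    rw [← h.law_count B hB, lintegral_map (by fun_prop) hm, h0] at h2
    simpa using h2
  have h2 : ∫⁻ ω, (1 - expNeg (N ω B)) ∂P = 0 := by
    rw [lintegral_sub (by fun_prop) (by simp [h1]) (ae_of_all _ fun ω => expNeg_le_one _), h1]
    simp
  rw [lintegral_eq_zero_iff (by fun_prop)] at h2
  filter_upwards [h2] with ω hω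
  have : expNeg (N ω B) = 1 := le_antisymm (expNeg_le_one _) (tsub_eq_zero_iff_le.1 hω)
  simpa using this

theorem IsPoissonProcess.ae_eq_top {Ω E : Type*} [MeasurableSpace Ω] [MeasurableSpace E]
    {N : Ω → Measure E} {μ : Measure E} {P : Measure Ω}
    (h : IsPoissonProcess N μ P) {B : Set E} (hB : MeasurableSet B) (h0 : μ B = ∞) :
    ∀ᵐ ω ∂P, N ω B = ∞ := by
  have hm : Measurable fun ω => N ω B := (Measure.measurable_coe hB).comp h.measurable
  have h1 := h.law_count B hB
  rw [poissonLaw, if_pos h0] at h1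
  have h2 : ∀ᵐ x ∂P.map fun ω => N ω B, x = ∞ := by
    rw [h1]
    exact (ae_dirac_iff (measurableSet_singleton _)).2 rfl
  exact ae_of_ae_map hm.aemeasurable h2

theorem IsPoissonProcess.hasPoissonLaplace {Ω : Type*} [MeasurableSpace Ω] {X : Ω → Measure ℝ}
    {ν : Measure ℝ} {P : Measure Ω} [IsProbabilityMeasure P] (h : IsPoissonProcess X ν P) :
    HasPoissonLaplace X ν P := fun _ hf _ => h.laplace hf.measurable

/-- The first moment of the intensity is finite, which bounds the sum; its total mass is infinite,
so there are almost surely infinitely many points. -/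
theorem IsPoissonProcess.ae_isMpf {Ω : Type*} [MeasurableSpace Ω] {X : Ω → Measure ℝ}
    {θ α : ℝ} (hθ : 0 < θ) (hα0 : 0 ≤ α) (hα : α < 1) {P : Measure Ω} [IsProbabilityMeasure P]
    (h : IsPoissonProcess X (jumpIntensity θ α) P) : ∀ᵐ ω ∂P, IsMpf (X ω) ∧ X ω ≠ 0 := by
  have ht : total (jumpIntensity θ α) ≠ ∞ := by
    rw [← powerMoment_zero]
    exact powerMoment_jumpIntensity_ne_top hθ hα 0
  filter_upwards [h.hasPoissonLaplace.ae_total_lt_top h.measurable.aemeasurable ht,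
    h.ae_eq_zero measurableSet_Iic (jumpIntensity_Iic_zero θ α),
    h.ae_eq_top MeasurableSet.univ (jumpIntensity_univ hθ hα0 hα)] with ω h1 h2 h3
  refine ⟨isMpf_of_total (h.counting ω) h2 h1, fun h0 => ?_⟩
  simp [h0] at h3

/-! ### The intensities of the processes -/

theorem lebPos_Iic (s : ℝ) : lebPos (Set.Iic s) = ENNReal.ofReal s := by
  rw [lebPos, Measure.restrict_apply measurableSet_Iic, Set.inter_comm, Set.Ioi_inter_Iic,
    Real.volume_Ioc, sub_zero]

theorem jumpsUpTo_prod (s : ℝ) (ν : Measure ℝ) [SFinite ν] :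
    jumpsUpTo s (lebPos.prod ν) = ENNReal.ofReal s • ν := by
  have : {q : ℝ × ℝ | q.1 ≤ s} = Set.Iic s ×ˢ Set.univ := by
    ext
    simp
  rw [jumpsUpTo, this, ← Measure.prod_restrict, Measure.map_snd_prod, Measure.restrict_univ,
    Measure.restrict_apply_univ, lebPos_Iic]

theorem IsPoissonProcess.jumpsUpTo {Ω : Type*} [MeasurableSpace Ω] {N : Ω → Measure (ℝ × ℝ)}
    {μ : Measure (ℝ × ℝ)} {P : Measure Ω} (h : IsPoissonProcess N μ P) (s : ℝ) :
    IsPoissonProcess (fun ω => jumpsUpTo s (N ω)) (jumpsUpTo s μ) P :=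
  h.restrict_map (measurableSet_le measurable_fst measurable_const) measurable_snd

theorem IsPoissonProcess.thin {Ω : Type*} [MeasurableSpace Ω] {N : Ω → Measure (ℝ × ℝ × ℝ)}
    {μ : Measure (ℝ × ℝ × ℝ)} {P : Measure Ω} (h : IsPoissonProcess N μ P) :
    IsPoissonProcess (fun ω => thin (N ω)) (thin μ) P :=
  h.restrict_map (measurableSet_le (by fun_prop) (by fun_prop)) (by fun_prop)

theorem gammaMeasure_eq_withDensity (a : ℝ) :
    gammaMeasure a 1 = lebPos.withDensity fun x =>
      ENNReal.ofReal ((Real.Gamma a)⁻¹ * x ^ (a - 1) * Real.exp (-x)) := by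
  rw [lebPos, ← withDensity_indicator measurableSet_Ioi, gammaMeasure]
  refine withDensity_congr_ae ?_
  have h0 : ∀ᵐ x : ℝ ∂volume, x ≠ 0 := by simp [ae_iff]
  filter_upwards [h0] with x hx
  rcases lt_or_gt_of_ne hx with h | h
  · rw [gammaPDF_of_neg h, Set.indicator_of_notMem (by simpa using h.le)]
  · rw [gammaPDF_of_nonneg h.le, Set.indicator_of_mem (by simpa using h)]
    simp

theorem expMeasure_eq_withDensity :
    expMeasure 1 = lebPos.withDensity fun x => ENNReal.ofReal (Real.exp (-x)) := by
  rw [expMeasure, gammaMeasure_eq_withDensity]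
  simp

theorem expMeasure_Ici {p : ℝ} (hp : 0 < p) :
    expMeasure 1 (Set.Ici p) = ENNReal.ofReal (Real.exp (-p)) := by
  have h : Set.Ici p ∩ Set.Ioi 0 = Set.Ici p :=
    Set.inter_eq_left.2 fun x hx => hp.trans_le hx
  rw [expMeasure_eq_withDensity, withDensity_apply _ measurableSet_Ici, lebPos,
    Measure.restrict_restrict measurableSet_Ici, h, ← restrict_Ioi_eq_restrict_Ici,
    ← ofReal_integral_eq_lintegral_ofReal (integrableOn_exp_neg_Ioi p)
      (ae_of_all _ fun x => (Real.exp_pos _).le), integral_exp_neg_Ioi]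

/-- An exponential mark is at least p with probability e^{-p}, which tilts the stable density. Its
constant α takes the place of θ until the time horizon θ/α rescales it. -/
theorem thin_prod {α : ℝ} (hα0 : 0 < α) (hα : α < 1) :
    thin (lebPos.prod ((stableLevy α).prod (expMeasure 1)))
      = lebPos.prod (jumpIntensity α α) := by
  have := isProbabilityMeasure_expMeasure one_pos
  have hset : {q : ℝ × ℝ × ℝ | q.2.1 ≤ q.2.2}
      = Set.univ ×ˢ {q : ℝ × ℝ | q.1 ≤ q.2} := by
    ext
    simp
  have hC : MeasurableSet {q : ℝ × ℝ | q.1 ≤ q.2} :=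
    measurableSet_le measurable_fst measurable_snd
  have hmap : (((stableLevy α).prod (expMeasure 1)).restrict {q | q.1 ≤ q.2}).map Prod.fst
      = jumpIntensity α α := by
    ext B hB
    rw [Measure.map_apply measurable_fst hB, Measure.restrict_apply (measurable_fst hB),
      Measure.prod_apply ((measurable_fst hB).inter hC)]
    have h1 : ∀ p : ℝ, 0 < p → expMeasure 1
        (Prod.mk p ⁻¹' (Prod.fst ⁻¹' B ∩ {q : ℝ × ℝ | q.1 ≤ q.2}))
        = B.indicator (fun p => ENNReal.ofReal (Real.exp (-p))) p := fun p hp => by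
      by_cases hpB : p ∈ B
      · rw [Set.indicator_of_mem hpB, ← expMeasure_Ici hp]
        congr 1
        ext e
        simp [hpB]
      · rw [Set.indicator_of_notMem hpB]
        convert measure_empty (μ := expMeasure 1)
        ext e
        simp [hpB]
    have h2 : Measurable (B.indicator fun p => ENNReal.ofReal (Real.exp (-p))) :=
      Measurable.indicator (by fun_prop) hB
    have hae : ∀ᵐ p ∂stableLevy α, 0 < p :=
      (withDensity_absolutelyContinuous _ _).ae_le (ae_lebPos fun x hx => hx)
    rw [lintegral_congr_ae (hae.mono h1), stableLevy,
      lintegral_withDensity_eq_lintegral_mul _ (by fun_prop) h2, jumpIntensity,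
      withDensity_apply _ hB, ← lintegral_indicator hB]
    refine lintegral_lebPos_congr fun x hx => ?_
    have hΓ := Real.Gamma_pos_of_pos (sub_pos.2 hα)
    by_cases hxB : x ∈ B
    · simp only [Pi.mul_apply, Set.indicator_of_mem hxB]
      rw [← ENNReal.ofReal_mul (by positivity), jumpDensity, mul_assoc, one_div,
        ← Real.rpow_neg hx.le]
      congr 4
      ring
    · simp [hxB]
  rw [PDLimit.thin, hset, ← Measure.prod_restrict, Measure.restrict_univ, ← hmap]
  conv_rhs => rw [← Measure.map_id (μ := lebPos)]
  exact (Measure.map_prod_map _ _ measurable_id measurable_fst).symm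

theorem smul_gammaLevy {θ : ℝ} (hθ : 0 < θ) :
    ENNReal.ofReal θ • gammaLevy = jumpIntensity θ 0 := by
  rw [gammaLevy, jumpIntensity, ← withDensity_smul _ (by fun_prop)]
  refine withDensity_congr_ae (ae_lebPos fun x hx => ?_)
  rw [Pi.smul_apply, smul_eq_mul, ← ENNReal.ofReal_mul hθ.le]
  simp [jumpDensity, Real.rpow_neg_one]

theorem smul_jumpIntensity {θ α c : ℝ} (hc : 0 < c) :
    ENNReal.ofReal c • jumpIntensity θ α = jumpIntensity (c * θ) α := by
  rw [jumpIntensity, jumpIntensity, ← withDensity_smul _ (measurable_jumpDensity _ _)]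
  congr 1
  ext x
  rw [Pi.smul_apply, smul_eq_mul, ← ENNReal.ofReal_mul hc.le, jumpDensity, jumpDensity]
  congr 1
  ring

instance (θ α : ℝ) : SFinite (jumpIntensity θ α) := by
  unfold jumpIntensity
  infer_instance

theorem isPoissonProcess_jumpsUpTo {Ω : Type*} [MeasurableSpace Ω] {P : Measure Ω}
    {N : Ω → Measure (ℝ × ℝ)} (h : IsPoissonProcess N (lebPos.prod gammaLevy) P)
    {θ : ℝ} (hθ : 0 < θ) :
    IsPoissonProcess (fun ω => jumpsUpTo θ (N ω)) (jumpIntensity θ 0) P := by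
  rw [← smul_gammaLevy hθ, ← jumpsUpTo_prod]
  exact h.jumpsUpTo θ

theorem isPoissonProcess_Nvee {Ω : Type*} [MeasurableSpace Ω] {P : Measure Ω} {α : ℝ}
    (hα0 : 0 < α) (hα : α < 1) {N : Ω → Measure (ℝ × ℝ × ℝ)}
    (h : IsPoissonProcess N (lebPos.prod ((stableLevy α).prod (expMeasure 1))) P)
    {θ : ℝ} (hθ : 0 < θ) :
    IsPoissonProcess (Nvee N (θ / α)) (jumpIntensity θ α) P := by
  have h1 := h.thin.jumpsUpTo (θ / α)
  rwa [thin_prod hα0 hα, jumpsUpTo_prod, smul_jumpIntensity (by positivity),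
    div_mul_cancel₀ _ hα0.ne'] at h1

/-! ### Marked renewal processes with exponential interarrival times -/

theorem lintegral_lebPos_of_hasDerivAt {g g' : ℝ → ℝ} {l : ℝ}
    (hd : ∀ x, 0 ≤ x → HasDerivAt g (g' x) x) (hpos : ∀ x, 0 < x → 0 ≤ g' x)
    (hl : Tendsto g atTop (𝓝 l)) :
    ∫⁻ x, ENNReal.ofReal (g' x) ∂lebPos = ENNReal.ofReal (l - g 0) := by
  have hi := integrableOn_Ioi_deriv_of_nonneg' (a := 0) hd hpos hl
  rw [lebPos, ← ofReal_integral_eq_lintegral_ofReal hi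
    ((ae_restrict_mem measurableSet_Ioi).mono hpos),
    integral_Ioi_of_hasDerivAt_of_nonneg' (a := 0) hd hpos hl]

/-- The function `a ↦ exp (-∫_a^∞ Q)`. -/
def tailExp (Q : ℝ → ℝ) (a : ℝ) : ℝ :=
  Real.exp (-((∫ x in Set.Ioi 0, Q x) - ∫ x in (0 : ℝ)..a, Q x))

theorem hasDerivAt_tailExp {Q : ℝ → ℝ} (hQ : Continuous Q) (a : ℝ) :
    HasDerivAt (tailExp Q) (tailExp Q a * Q a) a := by
  have h := (((hQ.integral_hasStrictDerivAt 0 a).hasDerivAt).const_sub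
    (∫ x in Set.Ioi 0, Q x)).neg.exp
  rwa [neg_neg] at h

theorem continuous_tailExp {Q : ℝ → ℝ} (hQ : Continuous Q) : Continuous (tailExp Q) :=
  continuous_iff_continuousAt.2 fun a => (hasDerivAt_tailExp hQ a).continuousAt

theorem tendsto_tailExp {Q : ℝ → ℝ} (hQi : IntegrableOn Q (Set.Ioi 0)) :
    Tendsto (tailExp Q) atTop (𝓝 1) := by
  have h := (intervalIntegral_tendsto_integral_Ioi 0 hQi tendsto_id).const_sub
    (∫ x in Set.Ioi 0, Q x)
  rw [sub_self] at h
  have h2 := (Real.continuous_exp.tendsto _).comp h.neg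
  rwa [neg_zero, Real.exp_zero] at h2

theorem tailExp_le_one {Q : ℝ → ℝ} (hQi : IntegrableOn Q (Set.Ioi 0)) (hQ0 : ∀ x, 0 ≤ Q x)
    {a : ℝ} (ha : 0 ≤ a) : tailExp Q a ≤ 1 := by
  rw [tailExp, Real.exp_le_one_iff, neg_nonpos, sub_nonneg, intervalIntegral.integral_of_le ha]
  exact setIntegral_mono_set hQi (ae_of_all _ hQ0) Set.Ioc_subset_Ioi_self.eventuallyLE

/-- Write Φ for `tailExp Q`. Since Φ' = QΦ, the integrand e^{-d}(1 - Q(a+d))Φ(a+d) is the derivative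
of -e^{-d}Φ(a+d). Probabilistically, this conditions on the first arrival after a. -/
theorem renewal_tailExp {Q : ℝ → ℝ} (hQ : Continuous Q) (hQi : IntegrableOn Q (Set.Ioi 0))
    (hQ1 : ∀ x, Q x ≤ 1) (a : ℝ) :
    ∫⁻ d, ENNReal.ofReal (1 - Q (a + d)) * ENNReal.ofReal (tailExp Q (a + d)) ∂expMeasure 1
      = ENNReal.ofReal (tailExp Q a) := by
  have hc := continuous_tailExp hQ
  rw [expMeasure_eq_withDensity, lintegral_withDensity_eq_lintegral_mul _ (by fun_prop)
    (by have := hQ.measurable; have := hc.measurable; fun_prop)]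
  have h1 : ∀ d, ENNReal.ofReal (Real.exp (-d)) * (ENNReal.ofReal (1 - Q (a + d))
      * ENNReal.ofReal (tailExp Q (a + d)))
      = ENNReal.ofReal (Real.exp (-d) * ((1 - Q (a + d)) * tailExp Q (a + d))) := fun d => by
    rw [ENNReal.ofReal_mul (Real.exp_pos _).le, ENNReal.ofReal_mul (by linarith [hQ1 (a + d)])]
  refine (lintegral_congr h1).trans ?_
  refine (lintegral_lebPos_of_hasDerivAt (g := fun d => -(Real.exp (-d) * tailExp Q (a + d)))
    (l := 0) (fun d _ => ?_) (fun d _ => ?_) ?_).trans (by simp)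
  · have hs : HasDerivAt (fun d => tailExp Q (a + d)) (tailExp Q (a + d) * Q (a + d)) d :=
      (hasDerivAt_tailExp hQ (a + d)).comp_const_add a d
    have he : HasDerivAt (fun d : ℝ => Real.exp (-d)) (-Real.exp (-d)) d := by
      simpa using (hasDerivAt_neg d).exp
    convert! (he.mul hs).neg using 1
    ring
  · have h2 : 0 ≤ tailExp Q (a + d) := (Real.exp_pos _).le
    have h3 : 0 ≤ 1 - Q (a + d) := by linarith [hQ1 (a + d)]
    positivity
  · have h2 : Tendsto (fun d => tailExp Q (a + d)) atTop (𝓝 1) :=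
      (tendsto_tailExp hQi).comp (tendsto_atTop_add_const_left _ a tendsto_id)
    have h3 : Tendsto (fun d : ℝ => Real.exp (-d)) atTop (𝓝 0) :=
      Real.tendsto_exp_neg_atTop_nhds_zero
    simpa using (h3.mul h2).neg

/-- The partial sum `D 0 + ⋯ + D (n-1)`, together with the product of the `h (Γ i) (G i)`, `i < n`,
where `Γ i` are the arrival times. -/
def renewalState {Ω : Type*} (h : ℝ → ℝ → ℝ≥0∞) (D G : ℕ → Ω → ℝ) (n : ℕ) (ω : Ω) :
    ℝ × ℝ≥0∞ :=
  (∑ j ∈ Finset.range n, D j ω, ∏ i ∈ Finset.range n, h (arrival D i ω) (G i ω))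

theorem measurable_renewalState {Ω : Type*} [MeasurableSpace Ω] {h : ℝ → ℝ → ℝ≥0∞}
    (hh : Measurable (Function.uncurry h)) {D G : ℕ → Ω → ℝ} {n : ℕ}
    (hD : ∀ i < n, Measurable (D i)) (hG : ∀ i < n, Measurable (G i)) :
    Measurable (renewalState h D G n) := by
  refine Measurable.prodMk ?_ ?_
  · exact Finset.measurable_fun_sum _ fun j hj => hD j (Finset.mem_range.1 hj)
  · refine Finset.measurable_fun_prod _ fun i hi => ?_
    have hi' := Finset.mem_range.1 hi
    have ha : Measurable (arrival D i) :=
      Finset.measurable_fun_sum _ fun j hj => hD j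
        ((Nat.lt_succ_iff.1 (Finset.mem_range.1 hj)).trans_lt hi')
    exact hh.comp (ha.prodMk (hG i hi'))

section

variable {Ω : Type*} [MeasurableSpace Ω] {P : Measure Ω}
  {D G : ℕ → Ω → ℝ} {γ : Measure ℝ}

theorem indepFun_renewalState {h : ℝ → ℝ → ℝ≥0∞} (hh : Measurable (Function.uncurry h))
    (hDm : ∀ i, Measurable (D i)) (hGm : ∀ i, Measurable (G i))
    (hDG : iIndepFun (fun k : ℕ ⊕ ℕ => Sum.elim D G k) P) (n : ℕ) :
    IndepFun (renewalState h D G n) (fun ω => (D n ω, G n ω)) P := by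
  let m : ℕ ⊕ ℕ → MeasurableSpace Ω := fun k =>
    MeasurableSpace.comap (Sum.elim D G k) inferInstance
  let S : Set (ℕ ⊕ ℕ) := {k | Sum.elim id id k < n}
  let T : Set (ℕ ⊕ ℕ) := {k | Sum.elim id id k = n}
  have hST : Disjoint S T := by
    rw [Set.disjoint_left]
    exact fun k hk hk' => (ne_of_lt hk) hk'
  have hind : Indep (⨆ k ∈ S, m k) (⨆ k ∈ T, m k) P := by
    refine indep_iSup_of_disjoint (fun k => ?_) hDG hST
    rcases k with k | k
    · exact (hDm k).comap_le
    · exact (hGm k).comap_le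
  have hmeas : ∀ (U : Set (ℕ ⊕ ℕ)) (k : ℕ ⊕ ℕ), k ∈ U →
      Measurable[⨆ k ∈ U, m k] (Sum.elim D G k) := fun U k hk =>
    measurable_iff_comap_le.2 (le_iSup₂ (f := fun k (_ : k ∈ U) => m k) k hk)
  refine indep_of_indep_of_le_left (indep_of_indep_of_le_right hind ?_) ?_
  · refine measurable_iff_comap_le.1 ?_
    exact @Measurable.prodMk _ _ _ (_) _ (_) _ _ (hmeas T (.inl n) rfl) (hmeas T (.inr n) rfl)
  · refine measurable_iff_comap_le.1 ?_
    exact @measurable_renewalState _ (_) h hh D G n (fun i hi => hmeas S (.inl i) hi)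
      (fun i hi => hmeas S (.inr i) hi)

theorem ae_pos_expMeasure : ∀ᵐ x ∂expMeasure 1, 0 < x := by
  rw [expMeasure_eq_withDensity]
  exact (withDensity_absolutelyContinuous _ _).ae_le (ae_lebPos fun x hx => hx)

theorem ae_pos_of_hasLaw (hD : ∀ i, HasLaw (D i) (expMeasure 1) P) :
    ∀ᵐ ω ∂P, ∀ i, 0 < D i ω := by
  refine ae_all_iff.2 fun i => ?_
  have := ae_pos_expMeasure
  rw [← (hD i).map_eq] at this
  exact ae_of_ae_map (hD i).aemeasurable this

/-- The product of the first n factors times Φ of the n-th partial sum behaves as a martingale: the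
next interarrival time and mark are independent of the state, and averaging over them is
`renewal_tailExp`. -/
theorem lintegral_renewal [IsProbabilityMeasure P] {h : ℝ → ℝ → ℝ≥0∞} (hh : Measurable (Function.uncurry h))
    [IsProbabilityMeasure γ] {Q : ℝ → ℝ} (hQ : Continuous Q) (hQi : IntegrableOn Q (Set.Ioi 0))
    (hQ1 : ∀ x, Q x ≤ 1) (hhQ : ∀ t, ∫⁻ g, h t g ∂γ = ENNReal.ofReal (1 - Q t))
    (hDm : ∀ i, Measurable (D i)) (hGm : ∀ i, Measurable (G i))
    (hD : ∀ i, HasLaw (D i) (expMeasure 1) P) (hG : ∀ i, HasLaw (G i) γ P)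
    (hDG : iIndepFun (fun k : ℕ ⊕ ℕ => Sum.elim D G k) P) (n : ℕ) :
    ∫⁻ ω, (renewalState h D G n ω).2 * ENNReal.ofReal (tailExp Q (renewalState h D G n ω).1) ∂P
      = ENNReal.ofReal (tailExp Q 0) := by
  have := isProbabilityMeasure_expMeasure one_pos
  have hΦ : Measurable fun x => ENNReal.ofReal (tailExp Q x) :=
    (continuous_tailExp hQ).measurable.ennreal_ofReal
  induction n with
  | zero => simp [renewalState]
  | succ n ih =>
    have hpair : P.map (fun ω => (D n ω, G n ω)) = (expMeasure 1).prod γ := by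
      have hi : IndepFun (D n) (G n) P := hDG.indepFun (i := .inl n) (j := .inr n) (by simp)
      rw [hi.map_prod_eq_prod_map_map (hDm n).aemeasurable (hGm n).aemeasurable,
        (hD n).map_eq, (hG n).map_eq]
    have hS : Measurable (renewalState h D G n) :=
      measurable_renewalState hh (fun i _ => hDm i) (fun i _ => hGm i)
    have hjoint := (indepFun_renewalState hh hDm hGm hDG n).map_prod_eq_prod_map_map
      hS.aemeasurable ((hDm n).prodMk (hGm n)).aemeasurable
    rw [hpair] at hjoint
    let F : (ℝ × ℝ≥0∞) × (ℝ × ℝ) → ℝ≥0∞ := fun q =>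
      q.1.2 * (h (q.1.1 + q.2.1) q.2.2 * ENNReal.ofReal (tailExp Q (q.1.1 + q.2.1)))
    have hhm : Measurable fun q : (ℝ × ℝ≥0∞) × (ℝ × ℝ) => h (q.1.1 + q.2.1) q.2.2 :=
      hh.comp (f := fun q : (ℝ × ℝ≥0∞) × (ℝ × ℝ) => (q.1.1 + q.2.1, q.2.2)) (by fun_prop)
    have hΦm : Measurable fun q : (ℝ × ℝ≥0∞) × (ℝ × ℝ) =>
        ENNReal.ofReal (tailExp Q (q.1.1 + q.2.1)) :=
      hΦ.comp (g := fun x => ENNReal.ofReal (tailExp Q x))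
        (f := fun q : (ℝ × ℝ≥0∞) × (ℝ × ℝ) => q.1.1 + q.2.1) (by fun_prop)
    have hF : Measurable F := (by fun_prop : Measurable fun q : (ℝ × ℝ≥0∞) × (ℝ × ℝ) =>
      q.1.2).mul (hhm.mul hΦm)
    have hstep : ∀ ω, (renewalState h D G (n + 1) ω).2
        * ENNReal.ofReal (tailExp Q (renewalState h D G (n + 1) ω).1)
        = F (renewalState h D G n ω, (D n ω, G n ω)) := fun ω => by
      simp only [renewalState, F, Finset.prod_range_succ, Finset.sum_range_succ, arrival, mul_assoc]
    have hinner : ∀ p : ℝ × ℝ≥0∞, ∫⁻ q, F (p, q) ∂(expMeasure 1).prod γ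
        = p.2 * ENNReal.ofReal (tailExp Q p.1) := fun p => by
      have hm2 : Measurable fun q : ℝ × ℝ => h (p.1 + q.1) q.2 * ENNReal.ofReal
          (tailExp Q (p.1 + q.1)) := (hhm.mul hΦm).comp (measurable_prodMk_left (x := p))
      simp only [F]
      rw [lintegral_const_mul _ hm2, lintegral_prod _ hm2.aemeasurable]
      congr 1
      rw [← renewal_tailExp hQ hQi hQ1 p.1]
      refine lintegral_congr fun d => ?_
      have hm3 : Measurable fun g => h (p.1 + d) g := hh.comp measurable_prodMk_left
      exact (lintegral_mul_const (ENNReal.ofReal (tailExp Q (p.1 + d))) hm3).trans (by rw [hhQ])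
    simp_rw [hstep]
    rw [← lintegral_map (f := F) hF (hS.prodMk ((hDm n).prodMk (hGm n))), hjoint,
      lintegral_prod _ hF.aemeasurable]
    simp_rw [hinner]
    have hm4 : Measurable fun p : ℝ × ℝ≥0∞ => p.2 * ENNReal.ofReal (tailExp Q p.1) :=
      measurable_snd.mul (hΦ.comp measurable_fst)
    rw [lintegral_map hm4 hS]
    exact ih

theorem lintegral_exp_neg_expMeasure :
    ∫⁻ x, ENNReal.ofReal (Real.exp (-x)) ∂expMeasure 1 = 2⁻¹ := by
  rw [expMeasure_eq_withDensity, lintegral_withDensity_eq_lintegral_mul _ (by fun_prop)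
    (by fun_prop)]
  have h1 : ∀ x : ℝ, ENNReal.ofReal (Real.exp (-x)) * ENNReal.ofReal (Real.exp (-x))
      = ENNReal.ofReal (Real.exp (-(2 * x))) := fun x => by
    rw [← ENNReal.ofReal_mul (Real.exp_pos _).le, ← Real.exp_add]
    congr 2
    ring
  refine (lintegral_congr h1).trans ?_
  refine (lintegral_lebPos_of_hasDerivAt (g := fun x => -(Real.exp (-(2 * x)) / 2)) (l := 0)
    (fun x _ => ?_) (fun x _ => (Real.exp_pos _).le) ?_).trans ?_
  · have := (((((hasDerivAt_id x).const_mul 2).neg).exp).div_const 2).neg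
    convert! this using 1
    simp
    ring
  · have : Tendsto (fun x : ℝ => Real.exp (-(2 * x))) atTop (𝓝 0) :=
      Real.tendsto_exp_neg_atTop_nhds_zero.comp (tendsto_id.const_mul_atTop two_pos)
    simpa using (this.div_const 2).neg
  · rw [← ENNReal.ofReal_ofNat 2, ← ENNReal.ofReal_inv_of_pos two_pos]
    simp

/-- With S_n the partial sums, E e^{-S_n} = 2^{-n} is summable, so almost surely ∑ e^{-S_n} < ∞ and
S_n → ∞. -/
theorem ae_tendsto_sum_atTop (hDm : ∀ i, Measurable (D i))
    (hD : ∀ i, HasLaw (D i) (expMeasure 1) P) (hind : iIndepFun D P) :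
    ∀ᵐ ω ∂P, Tendsto (fun n => ∑ j ∈ Finset.range n, D j ω) atTop atTop := by
  let E : ℕ → Ω → ℝ≥0∞ := fun n ω => ∏ j ∈ Finset.range n, ENNReal.ofReal (Real.exp (-D j ω))
  have hEm : ∀ n, Measurable (E n) := fun n =>
    Finset.measurable_fun_prod _ fun j _ => by have := hDm j; fun_prop
  have hE : ∀ n, ∫⁻ ω, E n ω ∂P = 2⁻¹ ^ n := fun n => by
    rw [lintegral_prod_eq_prod_lintegral_of_indepFun (Finset.range n)
      (fun j ω => ENNReal.ofReal (Real.exp (-D j ω)))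
      (hind.comp (fun _ x => ENNReal.ofReal (Real.exp (-x))) fun _ => by fun_prop)
      (fun j => by have := hDm j; fun_prop)]
    rw [Finset.prod_congr rfl fun j _ => ?_, Finset.prod_const, Finset.card_range]
    rw [← lintegral_exp_neg_expMeasure, ← (hD j).map_eq, lintegral_map (by fun_prop) (hDm j)]
  have hsum : ∫⁻ ω, ∑' n, E n ω ∂P ≠ ∞ := by
    rw [lintegral_tsum fun n => (hEm n).aemeasurable]
    simp_rw [hE]
    rw [ENNReal.tsum_geometric]
    simp
  filter_upwards [ae_lt_top (Measurable.tsum hEm) hsum] with ω hω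
  have h0 := (ENNReal.tendsto_toReal ENNReal.zero_ne_top).comp
    (ENNReal.tendsto_atTop_zero_of_tsum_ne_top hω.ne)
  have h1 : ∀ n, (E n ω).toReal = Real.exp (-∑ j ∈ Finset.range n, D j ω) := fun n => by
    rw [ENNReal.toReal_prod, ← Finset.sum_neg_distrib, Real.exp_sum]
    exact Finset.prod_congr rfl fun j _ => ENNReal.toReal_ofReal (Real.exp_pos _).le
  simp only [Function.comp_def, h1, ENNReal.toReal_zero] at h0
  exact tendsto_neg_atBot_iff.1 (Real.tendsto_exp_comp_nhds_zero.1 h0)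

/-- The generating functional of a marked Poisson process, in terms of the arrival times. -/
theorem lintegral_prod_arrival [IsProbabilityMeasure P] {h : ℝ → ℝ → ℝ≥0∞} (hh : Measurable (Function.uncurry h))
    (hh1 : ∀ t g, h t g ≤ 1) [IsProbabilityMeasure γ]
    (hcont : Continuous fun t => ∫⁻ g, h t g ∂γ)
    (hfin : ∫⁻ t, ∫⁻ g, (1 - h t g) ∂γ ∂lebPos ≠ ∞)
    (hDm : ∀ i, Measurable (D i)) (hGm : ∀ i, Measurable (G i))
    (hD : ∀ i, HasLaw (D i) (expMeasure 1) P) (hG : ∀ i, HasLaw (G i) γ P)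
    (hDG : iIndepFun (fun k : ℕ ⊕ ℕ => Sum.elim D G k) P) {Z : Ω → ℝ≥0∞}
    (hZ : ∀ᵐ ω ∂P, Tendsto (fun n => ∏ i ∈ Finset.range n, h (arrival D i ω) (G i ω)) atTop
      (𝓝 (Z ω))) :
    ∫⁻ ω, Z ω ∂P = expNeg (∫⁻ t, ∫⁻ g, (1 - h t g) ∂γ ∂lebPos) := by
  have hle : ∀ t, ∫⁻ g, h t g ∂γ ≤ 1 := fun t =>
    (lintegral_mono fun g => hh1 t g).trans (by simp)
  have hne : ∀ t, ∫⁻ g, h t g ∂γ ≠ ∞ := fun t => ne_top_of_le_ne_top ENNReal.one_ne_top (hle t)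
  let Q : ℝ → ℝ := fun t => 1 - (∫⁻ g, h t g ∂γ).toReal
  have hQc : Continuous Q := continuous_const.sub
    (continuous_iff_continuousAt.2 fun t =>
      (ENNReal.tendsto_toReal (hne t)).comp (hcont.tendsto t))
  have hQ1 : ∀ t, Q t ≤ 1 := fun t => sub_le_self _ ENNReal.toReal_nonneg
  have hQ0 : ∀ t, 0 ≤ Q t := fun t => sub_nonneg.2
    (ENNReal.toReal_le_of_le_ofReal zero_le_one (by simpa using hle t))
  have hhQ : ∀ t, ∫⁻ g, h t g ∂γ = ENNReal.ofReal (1 - Q t) := fun t => by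
    simp only [Q, sub_sub_cancel]
    rw [ENNReal.ofReal_toReal (hne t)]
  have hQeq : ∀ t, ∫⁻ g, (1 - h t g) ∂γ = ENNReal.ofReal (Q t) := fun t => by
    have hm : Measurable fun g => h t g := hh.comp measurable_prodMk_left
    rw [lintegral_sub hm (hne t) (ae_of_all _ (hh1 t)),
      lintegral_const, measure_univ, mul_one]
    simp only [Q]
    rw [ENNReal.ofReal_sub _ ENNReal.toReal_nonneg, ENNReal.ofReal_toReal (hne t),
      ENNReal.ofReal_one]
  simp_rw [hQeq] at hfin ⊢
  have hQi : IntegrableOn Q (Set.Ioi 0) := by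
    refine ⟨hQc.aestronglyMeasurable, ?_⟩
    rw [hasFiniteIntegral_iff_ofReal (ae_of_all _ hQ0)]
    exact lt_top_iff_ne_top.2 hfin
  have hR : expNeg (∫⁻ t, ENNReal.ofReal (Q t) ∂lebPos) = ENNReal.ofReal (tailExp Q 0) := by
    rw [lebPos, ← ofReal_integral_eq_lintegral_ofReal hQi (ae_of_all _ hQ0),
      expNeg_ofReal (integral_nonneg hQ0), tailExp]
    simp
  rw [hR]
  have hDind : iIndepFun D P := hDG.precomp (g := Sum.inl) Sum.inl_injective
  have hpos := ae_pos_of_hasLaw hD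
  -- The expectations equal Φ(0) for all n. Along almost every path the product tends to `Z` and
  -- Φ(S_n) to 1, with everything bounded by 1 because the partial sums are nonnegative.
  refine tendsto_nhds_unique (l := atTop) (f := fun n => ∫⁻ ω, (renewalState h D G n ω).2
    * ENNReal.ofReal (tailExp Q (renewalState h D G n ω).1) ∂P) ?_ ?_
  · refine tendsto_lintegral_of_dominated_convergence (fun _ => 1) (fun n => ?_) (fun n => ?_)
      (by simp) ?_
    · have hS : Measurable (renewalState h D G n) :=
        measurable_renewalState hh (fun i _ => hDm i) (fun i _ => hGm i)
      exact hS.snd.mul ((continuous_tailExp hQc).measurable.comp hS.fst).ennreal_ofReal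
    · filter_upwards [hpos] with ω hω
      have h1 : (renewalState h D G n ω).2 ≤ 1 := by
        simpa only [renewalState] using Finset.prod_le_one' fun i _ => hh1 _ _
      have h2 : 0 ≤ (renewalState h D G n ω).1 := by
        simpa only [renewalState] using Finset.sum_nonneg fun j _ => (hω j).le
      exact mul_le_one' h1 (ENNReal.ofReal_le_one.2 (tailExp_le_one hQi hQ0 h2))
    · filter_upwards [hZ, ae_tendsto_sum_atTop hDm hD hDind] with ω h1 h2
      have h3 : Tendsto (fun n => ENNReal.ofReal (tailExp Q (renewalState h D G n ω).1)) atTop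
          (𝓝 1) := by
        rw [← ENNReal.ofReal_one]
        exact (ENNReal.continuous_ofReal.tendsto 1).comp ((tendsto_tailExp hQi).comp h2)
      have := ENNReal.Tendsto.mul h1 (.inr ENNReal.one_ne_top) h3 (.inl one_ne_zero)
      simpa using! this
  · simp_rw [lintegral_renewal hh hQc hQi hQ1 hhQ hDm hGm hD hG hDG]
    exact tendsto_const_nhds

end

/-! ### The process `M^∨` -/

theorem lintegral_lebPos_mul_right {u : ℝ} (hu : 0 < u) {F : ℝ → ℝ≥0∞} (hF : Measurable F) :
    ∫⁻ z, F z ∂lebPos = ENNReal.ofReal u * ∫⁻ g, F (g * u) ∂lebPos := by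
  have h1 : (fun g => (Set.Ioi 0).indicator F (g * u))
      = (Set.Ioi 0).indicator fun g => F (g * u) := by
    ext g
    by_cases hg : 0 < g
    · simp [hg, mul_pos hg hu]
    · simp [hg, (mul_pos_iff_of_pos_right hu).not.2 hg]
  rw [lebPos, ← lintegral_indicator measurableSet_Ioi, ← lintegral_indicator measurableSet_Ioi,
    ← h1]
  conv_lhs => rw [← Real.smul_map_volume_mul_right hu.ne']
  rw [lintegral_smul_measure, lintegral_map (hF.indicator measurableSet_Ioi) (by fun_prop),
    abs_of_pos hu, smul_eq_mul]

theorem lintegral_gammaMeasure_mul {α u : ℝ} (hα : α < 1) (hu : 0 < u) {F : ℝ → ℝ≥0∞}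
    (hF : Measurable F) :
    ∫⁻ g, F (g * u) ∂gammaMeasure (1 - α) 1 = ∫⁻ z, ENNReal.ofReal
      ((Real.Gamma (1 - α))⁻¹ * z ^ (-α) * (u⁻¹ ^ (1 - α) * Real.exp (-(z * u⁻¹)))) * F z
      ∂lebPos := by
  have hΓ := Real.Gamma_pos_of_pos (sub_pos.2 hα)
  rw [gammaMeasure_eq_withDensity, lintegral_withDensity_eq_lintegral_mul _ (by fun_prop)
    (by fun_prop)]
  symm
  rw [lintegral_lebPos_mul_right hu (by fun_prop), ← lintegral_const_mul _ (by fun_prop)]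
  refine lintegral_lebPos_congr fun g hg => ?_
  simp only [Pi.mul_apply]
  rw [← mul_assoc, ← ENNReal.ofReal_mul hu.le]
  congr 2
  rw [mul_inv_cancel_right₀ hu.ne', Real.mul_rpow hg.le hu.le, Real.inv_rpow hu.le,
    Real.rpow_sub hu, Real.rpow_one, Real.rpow_neg hu.le]
  have : 0 < u ^ α := Real.rpow_pos_of_pos hu α
  have h1 : 1 - α - 1 = -α := by ring
  rw [h1]
  field_simp

/-- With s = θ/α and w = (1 + t/s)^{1/α}, the factor w^{1-α} equals θ dw/dt because αs = θ. Hence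
w^{1-α}e^{-zw} has primitive -(θ/z)e^{-zw}, and only t = 0, where w = 1, contributes. -/
theorem lintegral_ratio {α θ z : ℝ} (hα0 : 0 < α) (hα : α < 1) (hθ : 0 < θ) (hz : 0 < z) :
    ∫⁻ t, ENNReal.ofReal ((Real.Gamma (1 - α))⁻¹ * z ^ (-α)
      * (((θ / α / (θ / α + t)) ^ (1 / α))⁻¹ ^ (1 - α)
        * Real.exp (-(z * ((θ / α / (θ / α + t)) ^ (1 / α))⁻¹)))) ∂lebPos
      = ENNReal.ofReal (jumpDensity θ α z) := by
  have hΓ := Real.Gamma_pos_of_pos (sub_pos.2 hα)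
  have hs : 0 < θ / α := by positivity
  set s := θ / α with hs_def
  set c := (Real.Gamma (1 - α))⁻¹ * z ^ (-α) with hc
  have hc0 : 0 < c := by have := Real.rpow_pos_of_pos hz (-α); positivity
  have hw : ∀ t, 0 ≤ t → ((s / (s + t)) ^ (1 / α))⁻¹ = (1 + t / s) ^ (1 / α) := fun t ht => by
    rw [← Real.inv_rpow (by positivity), inv_div, add_div, div_self hs.ne']
  have hb : ∀ t, 0 ≤ t → 0 < 1 + t / s := fun t ht => by positivity
  have hw' : ∀ t, 0 ≤ t → ((1 + t / s) ^ (1 / α)) ^ (1 - α) = (1 + t / s) ^ (1 / α - 1) :=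
    fun t ht => by
      rw [← Real.rpow_mul (hb t ht).le]
      congr 1
      field_simp
  have hcongr : ∀ t, 0 < t → ENNReal.ofReal (c * (((s / (s + t)) ^ (1 / α))⁻¹ ^ (1 - α)
        * Real.exp (-(z * ((s / (s + t)) ^ (1 / α))⁻¹))))
      = ENNReal.ofReal (c * ((1 + t / s) ^ (1 / α - 1)
        * Real.exp (-(z * (1 + t / s) ^ (1 / α))))) := fun t ht => by
    rw [hw t ht.le, hw' t ht.le]
  rw [lintegral_lebPos_congr hcongr]
  refine (lintegral_lebPos_of_hasDerivAt
    (g := fun t => -(c * (θ / z) * Real.exp (-(z * (1 + t / s) ^ (1 / α))))) (l := 0)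
    (fun t ht => ?_) (fun t ht => ?_) ?_).trans ?_
  · have h1 : HasDerivAt (fun t => 1 + t / s) (1 / s) t :=
      ((hasDerivAt_id t).div_const s).const_add 1
    have h2 := ((((h1.rpow_const (p := 1 / α) (.inl (hb t ht).ne')).const_mul z).neg.exp).const_mul
      (c * (θ / z))).neg
    convert! h2 using 1
    simp only [Pi.neg_apply]
    rw [hs_def]
    field_simp
  · have := Real.rpow_pos_of_pos (hb t ht.le) (1 / α - 1)
    positivity
  · have h1 : Tendsto (fun t => z * (1 + t / s) ^ (1 / α)) atTop atTop :=
      ((tendsto_rpow_atTop (by positivity)).comp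
        (tendsto_atTop_add_const_left _ 1 (tendsto_id.atTop_div_const hs))).const_mul_atTop hz
    have h2 := (Real.tendsto_exp_neg_atTop_nhds_zero.comp h1).const_mul (c * (θ / z))
    simpa using h2.neg
  · congr 1
    rw [jumpDensity, hc, Real.rpow_sub hz, Real.rpow_one]
    simp
    field_simp

/-- The image of `dt ⊗ gamma(1-α,1)` under `(t, g) ↦ g (s / (s + t))^{1/α}`. -/
theorem lintegral_lebPos_gammaMeasure {α θ : ℝ} (hα0 : 0 < α) (hα : α < 1) (hθ : 0 < θ)
    {F : ℝ → ℝ≥0∞} (hF : Measurable F) :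
    ∫⁻ t, ∫⁻ g, F (g * (θ / α / (θ / α + t)) ^ (1 / α)) ∂gammaMeasure (1 - α) 1 ∂lebPos
      = ∫⁻ z, F z ∂jumpIntensity θ α := by
  have hs : 0 < θ / α := by positivity
  have h1 : ∀ t, 0 < t → 0 < (θ / α / (θ / α + t)) ^ (1 / α) := fun t ht => by positivity
  rw [lintegral_lebPos_congr fun t ht => lintegral_gammaMeasure_mul hα (h1 t ht) hF,
    lintegral_lintegral_swap (Measurable.aemeasurable (by fun_prop)),
    lintegral_jumpIntensity _ _ hF]
  refine lintegral_lebPos_congr fun z hz => ?_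
  rw [lintegral_mul_const _ (by fun_prop), lintegral_ratio hα0 hα hθ hz]

section

variable {Ω : Type*} {D G : ℕ → Ω → ℝ}

theorem isCounting_Mvee (α s : ℝ) (ω : Ω) : IsCounting (Mvee α D G s ω) :=
  ⟨ℕ, inferInstance, _, rfl⟩

theorem Mvee_ne_zero (α s : ℝ) (ω : Ω) : Mvee α D G s ω ≠ 0 := by
  rw [Mvee, Ne, Measure.sum_eq_zero]
  exact fun h => Measure.dirac_ne_zero (h 0)

theorem lintegral_Mvee (α s : ℝ) (ω : Ω) {f : ℝ → ℝ≥0∞} (hf : Measurable f) :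
    ∫⁻ x, f x ∂Mvee α D G s ω
      = ∑' i, f (G i ω * (s / (s + arrival D i ω)) ^ (1 / α)) := by
  rw [Mvee, lintegral_sum_measure]
  exact tsum_congr fun i => lintegral_dirac' _ hf

variable [MeasurableSpace Ω] {P : Measure Ω}

theorem measurable_Mvee (hDm : ∀ i, Measurable (D i)) (hGm : ∀ i, Measurable (G i)) (α s : ℝ) :
    Measurable (Mvee α D G s) := by
  refine Measure.measurable_of_measurable_coe _ fun B hB => ?_
  have h1 : ∀ ω, Mvee α D G s ω B
      = ∑' i, B.indicator 1 (G i ω * (s / (s + arrival D i ω)) ^ (1 / α)) := fun ω => by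
    rw [← lintegral_Mvee _ _ _ (measurable_one.indicator hB), lintegral_indicator_one hB]
  simp_rw [h1]
  refine Measurable.tsum fun i => (measurable_one.indicator hB).comp ?_
  have ha : Measurable (arrival D i) := Finset.measurable_fun_sum _ fun j _ => hDm j
  have := hGm i
  fun_prop

theorem ae_pos_gammaMeasure (a : ℝ) : ∀ᵐ x ∂gammaMeasure a 1, 0 < x := by
  rw [gammaMeasure_eq_withDensity]
  exact (withDensity_absolutelyContinuous _ _).ae_le (ae_lebPos fun x hx => hx)

theorem hasPoissonLaplace_Mvee [IsProbabilityMeasure P] {α θ : ℝ} (hα0 : 0 < α) (hα : α < 1)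
    (hθ : 0 < θ) (hDm : ∀ i, Measurable (D i)) (hGm : ∀ i, Measurable (G i))
    (hD : ∀ i, HasLaw (D i) (expMeasure 1) P)
    (hG : ∀ i, HasLaw (G i) (gammaMeasure (1 - α) 1) P)
    (hDG : iIndepFun (fun k : ℕ ⊕ ℕ => Sum.elim D G k) P) :
    HasPoissonLaplace (Mvee α D G (θ / α)) (jumpIntensity θ α) P := by
  intro f hf hfin
  have hγ := isProbabilityMeasure_gammaMeasure (sub_pos.2 hα) one_pos
  have hs : 0 < θ / α := by positivity
  -- Replacing t by its positive part makes `r` continuous on the whole line, as the renewal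
  -- argument needs, and changes nothing at arrival times, which are almost surely nonnegative.
  let r : ℝ → ℝ := fun t => (θ / α / (θ / α + max t 0)) ^ (1 / α)
  have hr : Continuous r := by
    refine Continuous.rpow_const (continuous_const.div (by fun_prop) fun t => ?_)
      fun t => .inr (by positivity)
    positivity
  let h : ℝ → ℝ → ℝ≥0∞ := fun t g => expNeg (f (g * r t))
  have hc : Continuous (Function.uncurry h) :=
    continuous_expNeg.comp (hf.comp (continuous_snd.mul (hr.comp continuous_fst)))
  have hcont : Continuous fun t => ∫⁻ g, h t g ∂gammaMeasure (1 - α) 1 := by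
    refine continuous_iff_continuousAt.2 fun t => ?_
    refine tendsto_lintegral_filter_of_dominated_convergence (fun _ => 1)
      (Eventually.of_forall fun t => ?_)
      (Eventually.of_forall fun t => ae_of_all _ fun g => expNeg_le_one _) (by simp)
      (ae_of_all _ fun g => ?_)
    · exact hc.measurable.comp measurable_prodMk_left
    · exact (hc.comp (f := fun t => (t, g)) (by fun_prop)).tendsto t
  have hint : ∫⁻ t, ∫⁻ g, (1 - h t g) ∂gammaMeasure (1 - α) 1 ∂lebPos
      = ∫⁻ z, (1 - expNeg (f z)) ∂jumpIntensity θ α := by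
    have hm : Measurable fun z => 1 - expNeg (f z) :=
      (continuous_one_sub_expNeg.comp hf).measurable
    rw [← lintegral_lebPos_gammaMeasure hα0 hα hθ hm]
    refine lintegral_lebPos_congr fun t ht => ?_
    simp only [h, r, max_eq_left ht.le]
  have hint' : ∫⁻ t, ∫⁻ g, (1 - h t g) ∂gammaMeasure (1 - α) 1 ∂lebPos ≠ ∞ := by
    rw [hint]
    exact ne_top_of_le_ne_top hfin (lintegral_mono fun z => one_sub_expNeg_le _)
  rw [← hint]
  refine lintegral_prod_arrival hc.measurable (fun t g => expNeg_le_one _) hcont hint'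
    hDm hGm hD hG hDG ?_
  filter_upwards [ae_pos_of_hasLaw hD] with ω hω
  have ha : ∀ i, 0 ≤ arrival D i ω := fun i => Finset.sum_nonneg fun j _ => (hω j).le
  have hsum := ENNReal.tendsto_nat_tsum
    fun i => f (G i ω * (θ / α / (θ / α + arrival D i ω)) ^ (1 / α))
  rw [← lintegral_Mvee _ _ _ hf.measurable] at hsum
  refine ((continuous_expNeg.tendsto _).comp hsum).congr fun n => ?_
  simp only [Function.comp_apply, expNeg_sum, h, r, max_eq_left (ha _)]

theorem ae_isMpf_Mvee [IsProbabilityMeasure P] {α θ : ℝ} (hα0 : 0 < α) (hα : α < 1)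
    (hθ : 0 < θ) (hDm : ∀ i, Measurable (D i)) (hGm : ∀ i, Measurable (G i))
    (hD : ∀ i, HasLaw (D i) (expMeasure 1) P)
    (hG : ∀ i, HasLaw (G i) (gammaMeasure (1 - α) 1) P)
    (hDG : iIndepFun (fun k : ℕ ⊕ ℕ => Sum.elim D G k) P) :
    ∀ᵐ ω ∂P, IsMpf (Mvee α D G (θ / α) ω) ∧ Mvee α D G (θ / α) ω ≠ 0 := by
  have ht : total (jumpIntensity θ α) ≠ ∞ := by
    rw [← powerMoment_zero]
    exact powerMoment_jumpIntensity_ne_top hθ hα 0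
  have hGpos : ∀ᵐ ω ∂P, ∀ i, 0 < G i ω := by
    refine ae_all_iff.2 fun i => ?_
    have := ae_pos_gammaMeasure (1 - α)
    rw [← (hG i).map_eq] at this
    exact ae_of_ae_map (hG i).aemeasurable this
  filter_upwards [(hasPoissonLaplace_Mvee hα0 hα hθ hDm hGm hD hG hDG).ae_total_lt_top
    (measurable_Mvee hDm hGm _ _).aemeasurable ht, ae_pos_of_hasLaw hD, hGpos] with ω h1 h2 h3
  refine ⟨isMpf_of_total (isCounting_Mvee _ _ _) ?_ h1, Mvee_ne_zero _ _ _⟩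
  have ha : ∀ i, 0 ≤ arrival D i ω := fun i => Finset.sum_nonneg fun j _ => (h2 j).le
  rw [← lintegral_indicator_one measurableSet_Iic,
    lintegral_Mvee _ _ _ (measurable_one.indicator measurableSet_Iic), ENNReal.tsum_eq_zero]
  intro i
  refine Set.indicator_of_notMem ?_ _
  have hs : 0 < θ / α := by positivity
  have := ha i
  have := h3 i
  rw [Set.mem_Iic, not_le]
  positivity

/-- `M^∨` is a.e. measurable, almost surely non-zero with finite sum, and has the Laplace functional
of a Poisson process with intensity `jumpIntensity θ α`. -/
theorem Mvee_properties [IsProbabilityMeasure P] {α θ : ℝ} (hα0 : 0 < α) (hα : α < 1)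
    (hθ : 0 < θ) (hD : ∀ i, HasLaw (D i) (expMeasure 1) P)
    (hG : ∀ i, HasLaw (G i) (gammaMeasure (1 - α) 1) P)
    (hDG : iIndepFun (fun k : ℕ ⊕ ℕ => Sum.elim D G k) P) :
    AEMeasurable (Mvee α D G (θ / α)) P ∧
      (∀ᵐ ω ∂P, IsMpf (Mvee α D G (θ / α) ω) ∧ Mvee α D G (θ / α) ω ≠ 0) ∧
      HasPoissonLaplace (Mvee α D G (θ / α)) (jumpIntensity θ α) P := by
  -- `HasLaw` gives only almost everywhere measurability, so the argument is run for measurable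
  -- versions; countably many null sets are discarded.
  let D' : ℕ → Ω → ℝ := fun i => (hD i).aemeasurable.mk (D i)
  let G' : ℕ → Ω → ℝ := fun i => (hG i).aemeasurable.mk (G i)
  have hDm : ∀ i, Measurable (D' i) := fun i => (hD i).aemeasurable.measurable_mk
  have hGm : ∀ i, Measurable (G' i) := fun i => (hG i).aemeasurable.measurable_mk
  have hDe : ∀ i, D i =ᵐ[P] D' i := fun i => (hD i).aemeasurable.ae_eq_mk
  have hGe : ∀ i, G i =ᵐ[P] G' i := fun i => (hG i).aemeasurable.ae_eq_mk
  have hD' : ∀ i, HasLaw (D' i) (expMeasure 1) P := fun i => (hD i).congr (hDe i).symm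
  have hG' : ∀ i, HasLaw (G' i) (gammaMeasure (1 - α) 1) P := fun i => (hG i).congr (hGe i).symm
  have hDG' : iIndepFun (fun k : ℕ ⊕ ℕ => Sum.elim D' G' k) P := by
    refine hDG.congr fun k => ?_
    rcases k with k | k
    · exact hDe k
    · exact hGe k
  have he : ∀ᵐ ω ∂P, Mvee α D G (θ / α) ω = Mvee α D' G' (θ / α) ω := by
    filter_upwards [ae_all_iff.2 hDe, ae_all_iff.2 hGe] with ω h1 h2
    simp only [Mvee, arrival, h1, h2]
  refine ⟨⟨_, measurable_Mvee hDm hGm _ _, he⟩, ?_, fun f hf hfin => ?_⟩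
  · filter_upwards [he, ae_isMpf_Mvee hα0 hα hθ hDm hGm hD' hG' hDG'] with ω h1 h2
    rwa [h1]
  · rw [← hasPoissonLaplace_Mvee hα0 hα hθ hDm hGm hD' hG' hDG' f hf hfin]
    exact lintegral_congr_ae (he.mono fun ω h => by simp only [h])

end

end

end PDLimit

/-! ### Convergence of the self-normalized processes -/

theorem proposition4p1 (θ : ℝ) (hθ : 0 < θ)
    -- the Poisson process of jumps of the gamma subordinator, whose self-normalization up to
    -- time `θ` has the PD(0,θ) distribution
    {Ω₀ : Type*} [MeasurableSpace Ω₀] (P₀ : Measure Ω₀) [IsProbabilityMeasure P₀]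
    (N₀ : Ω₀ → Measure (ℝ × ℝ))
    (hN₀ : PDLimit.IsPoissonProcess N₀ (PDLimit.lebPos.prod PDLimit.gammaLevy) P₀)
    -- for each `α ∈ (0,1)`, the Poisson process of stable jumps with standard exponential marks
    {Ω : Set.Ioo (0 : ℝ) 1 → Type*} [∀ α, MeasurableSpace (Ω α)]
    (P : ∀ α, Measure (Ω α)) [∀ α, IsProbabilityMeasure (P α)]
    (N : ∀ α, Ω α → Measure (ℝ × ℝ × ℝ))
    (hN : ∀ α, PDLimit.IsPoissonProcess (N α)
      (PDLimit.lebPos.prod ((PDLimit.stableLevy α).prod (expMeasure 1))) (P α))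
    -- for each `α ∈ (0,1)`, i.i.d. standard exponential variables `D` and, independent of them,
    -- i.i.d. gamma(1-α,1) variables `G`
    {Ω' : Set.Ioo (0 : ℝ) 1 → Type*} [∀ α, MeasurableSpace (Ω' α)]
    (P' : ∀ α, Measure (Ω' α)) [∀ α, IsProbabilityMeasure (P' α)]
    (D G : ∀ α, ℕ → Ω' α → ℝ)
    (hD : ∀ α i, HasLaw (D α i) (expMeasure 1) (P' α))
    (hG : ∀ α i, HasLaw (G α i) (gammaMeasure (1 - (α : ℝ)) 1) (P' α))
    (hDG : ∀ α, iIndepFun (fun k : ℕ ⊕ ℕ => Sum.elim (D α) (G α) k) (P' α)) :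
    -- the self-normalizations are almost surely well defined
    ((∀ᵐ ω ∂P₀, PDLimit.IsMpf (PDLimit.jumpsUpTo θ (N₀ ω)) ∧ PDLimit.jumpsUpTo θ (N₀ ω) ≠ 0) ∧
      (∀ α : Set.Ioo (0 : ℝ) 1, ∀ᵐ ω ∂P α, PDLimit.IsMpf (PDLimit.Nvee (N α) (θ / α) ω) ∧
        PDLimit.Nvee (N α) (θ / α) ω ≠ 0) ∧
      (∀ α : Set.Ioo (0 : ℝ) 1, ∀ᵐ ω ∂P' α, PDLimit.IsMpf (PDLimit.Mvee α (D α) (G α) (θ / α) ω) ∧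
        PDLimit.Mvee α (D α) (G α) (θ / α) ω ≠ 0)) ∧
    -- convergence in distribution, as `α → 0`, to PD(0,θ)
    TendstoInDistribution
      (fun (α : Set.Ioo (0 : ℝ) 1) ω => PDLimit.selfNormalize (PDLimit.Nvee (N α) (θ / α) ω))
      (comap (fun α : Set.Ioo (0 : ℝ) 1 => (α : ℝ)) (𝓝 0))
      (fun ω => PDLimit.selfNormalize (PDLimit.jumpsUpTo θ (N₀ ω))) P P₀ ∧
    TendstoInDistribution
      (fun (α : Set.Ioo (0 : ℝ) 1) ω => PDLimit.selfNormalize (PDLimit.Mvee α (D α) (G α) (θ / α) ω))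
      (comap (fun α : Set.Ioo (0 : ℝ) 1 => (α : ℝ)) (𝓝 0))
      (fun ω => PDLimit.selfNormalize (PDLimit.jumpsUpTo θ (N₀ ω))) P' P₀ := by
  have h0 := PDLimit.isPoissonProcess_jumpsUpTo hN₀ hθ
  have hNv := fun α : Set.Ioo (0 : ℝ) 1 =>
    PDLimit.isPoissonProcess_Nvee α.2.1 α.2.2 (hN α) hθ
  have hMv := fun α : Set.Ioo (0 : ℝ) 1 =>
    PDLimit.Mvee_properties α.2.1 α.2.2 hθ (hD α) (hG α) (hDG α)
  have hgood₀ := h0.ae_isMpf hθ le_rfl zero_lt_one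
  have hgoodN := fun α : Set.Ioo (0 : ℝ) 1 => (hNv α).ae_isMpf hθ α.2.1.le α.2.2
  -- One limit serves both families, since for each α their Laplace functionals at `powerTest n`
  -- coincide.
  have hlim : ∀ n : ℕ →₀ ℕ, Tendsto (fun α : Set.Ioo (0 : ℝ) 1 => PDLimit.expNeg
      (∫⁻ x, (1 - PDLimit.expNeg (PDLimit.powerTest n x)) ∂PDLimit.jumpIntensity θ α))
      (comap (fun α : Set.Ioo (0 : ℝ) 1 => (α : ℝ)) (𝓝 0))
      (𝓝 (∫⁻ ω, PDLimit.expNeg (∫⁻ x, PDLimit.powerTest n x ∂PDLimit.jumpsUpTo θ (N₀ ω)) ∂P₀)) := by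
    intro n
    have hn := PDLimit.continuous_powerTest n
    rw [h0.laplace hn.measurable]
    exact (PDLimit.continuous_expNeg.tendsto _).comp
      (PDLimit.tendsto_lintegral_jumpIntensity hθ hn.measurable
        (PDLimit.lintegral_powerTest_jumpIntensity_ne_top hθ zero_lt_one n)
        (PDLimit.lintegral_powerTest_jumpIntensity_ne_top hθ (by norm_num) n))
  refine ⟨⟨hgood₀, hgoodN, fun α => (hMv α).2.1⟩, ?_, ?_⟩
  · refine PDLimit.tendstoInDistribution_selfNormalize (fun α => (hNv α).measurable.aemeasurable)
      h0.measurable.aemeasurable hgoodN hgood₀ fun n => (hlim n).congr fun α => ?_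
    exact ((hNv α).laplace (PDLimit.continuous_powerTest n).measurable).symm
  · refine PDLimit.tendstoInDistribution_selfNormalize (fun α => (hMv α).1)
      h0.measurable.aemeasurable (fun α => (hMv α).2.1) hgood₀ fun n => (hlim n).congr fun α => ?_
    exact ((hMv α).2.2 _ (PDLimit.continuous_powerTest n)
      (PDLimit.lintegral_powerTest_jumpIntensity_ne_top hθ α.2.2 n)).symm
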